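/- Let $n\ge 2$ and $\mathbb{Y}^{2n}=\mathbb{S}^{n-1}\times\mathbb{R}\times\mathbb{R}^n$, where $\mathbb{S}^{n-1}\subset\mathbb{R}^n$ is the unit sphere with its normalized surface measure $d\mathbf{u}$. Let $\mathcal{S}(\mathbb{Y}^{2n})$ be the space of all $\Phi\in C^\infty(\mathbb{Y}^{2n})$ (complex-valued) such that $$\rho^{l,m,k}_{s,r}(\Phi)=\sup_{(\mathbf{u},b,\mathbf{a})\in\mathbb{Y}^{2n}}(1+|b|^2)^{r/2}(1+|\mathbf{a}|^2)^{s/2}\,\bigl|\partial_{\mathbf{a}}^{l}\partial_b^{m}\Delta_{\mathbf{u}}^{k}\Phi(\mathbf{u},b,\mathbf{a})\bigr|<\infty$$ for all $s,r,m,k\in\mathbb{N}_0$ and $l\in\mathbb{N}_0^n$, where $\Delta_{\mathbf{u}}$ is the Laplace–Beltrami operator of $\mathbb{S}^{n-1}$, with the locally convex topology generated by these seminorms; $\mathcal{S}(\mathbb{R})$ and $\mathcal{S}(\mathbb{R}^n)$ are the usual spaces of complex-valued Schwartz functions. Let $\alpha=(\alpha_1,\dots,\alpha_n)$ with $\alpha_k\in(-\pi,\pi)\setminus\{0\}$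 for every $k$. For $\beta=(\beta_1,\dots,\beta_n)\in\mathbb{R}^n$ with no $\beta_k$ in $\pi\mathbb{Z}$ put $$K_{\beta}(\mathbf{x},\mathbf{a})=\prod_{k=1}^n \sqrt{\frac{1-i\cot\beta_k}{2\pi}}\;\exp\Bigl(i\Bigl(\frac{x_k^2+a_k^2}{2}\cot\beta_k-x_ka_k\csc\beta_k\Bigr)\Bigr)$$ with the principal square root. For $\Phi\in\mathcal{S}(\mathbb{Y}^{2n})$, $\psi\in\mathcal{S}(\mathbb{R})$ and $\mathbf{x}\in\mathbb{R}^n$ let $$(DS_\psi^\alpha)^*\Phi(\mathbf{x})=\int_{\mathbb{S}^{n-1}}\int_{\mathbb{R}^n}\int_{\mathbb{R}}\Phi(\mathbf{u},b,\mathbf{a})\,\psi(\mathbf{x}\cdot\mathbf{u}-b)\,K_{-\alpha}(\mathbf{x},\mathbf{a})\,db\,d\mathbf{a}\,d\mathbf{u}.$$ Then this integral is absolutely convergent, $(DS_\psi^\alpha)^*\Phi\in\mathcal{S}(\mathbb{R}^n)$, and the map $(\Phi,\psi)\mapsto(DS_\psi^\alpha)^*\Phi$ from $\mathcal{S}(\mathbb{Y}^{2n})\times\mathcal{S}(\mathbb{R})$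 (with the product topology) to $\mathcal{S}(\mathbb{R}^n)$ is bilinear and continuous. -/

import Mathlib

open Real MeasureTheory
open scoped ContDiff Manifold SchwartzMap

noncomputable section

namespace DSTFRFT

/-- Euclidean space `ℝⁿ`. -/
abbrev E (n : ℕ) := EuclideanSpace ℝ (Fin n)

/-- The unit sphere `𝕊^{n-1} ⊂ ℝⁿ`. -/
abbrev Sph (n : ℕ) := Metric.sphere (0 : E n) 1

/-- `𝕐^{2n} = 𝕊^{n-1} × ℝ × ℝⁿ`, with points `(u, b, a)`. -/
abbrev Y (n : ℕ) := Sph n × ℝ × E n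

/-! ### The fractional Fourier kernel -/

/-- The one-dimensional kernel
`K_α(x, ξ) = C_α exp (i ((x² + ξ²) / 2 · cot α - x ξ csc α))`, `C_α = √((1 - i cot α) / (2π))`
(principal square root), for `α ∉ π ℤ`. -/
def kernel1 (α x ξ : ℝ) : ℂ :=
  ((1 - Complex.I * (Real.cot α : ℂ)) / (2 * (π : ℂ))) ^ (1 / 2 : ℂ) *
    Complex.exp (Complex.I *
      (((x ^ 2 + ξ ^ 2) / 2 * Real.cot α - x * ξ * (1 / Real.sin α) : ℝ) : ℂ))

/-- The kernel `K_α(x, ξ) = ∏ₖ K_{αₖ}(xₖ, ξₖ)` on `ℝⁿ × ℝⁿ`. -/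
def kernel {n : ℕ} (α : Fin n → ℝ) (x ξ : E n) : ℂ :=
  ∏ k, kernel1 (α k) (x k) (ξ k)

/-! ### The measure `db da du` -/

/-- The normalized surface measure on `𝕊^{n-1}`. -/
def sphereMeasure (n : ℕ) : Measure (Sph n) :=
  ((volume : Measure (E n)).toSphere Set.univ)⁻¹ • (volume : Measure (E n)).toSphere

/-- The standard measure `db da du` on `𝕐^{2n}`. -/
def measureY (n : ℕ) : Measure (Y n) :=
  (sphereMeasure n).prod volume

/-! ### Smooth functions on `𝕐^{2n}` and differential operators on them -/

section Operators

variable {n : ℕ}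

/-- `∂Φ/∂b`. -/
def partialB (Φ : Y n → ℂ) : Y n → ℂ :=
  fun p => deriv (fun t : ℝ => Φ (p.1, t, p.2.2)) p.2.1

/-- `∂Φ/∂aⱼ`. -/
def partialA (j : Fin n) (Φ : Y n → ℂ) : Y n → ℂ :=
  fun p => deriv (fun t : ℝ => Φ (p.1, p.2.1, p.2.2 + t • EuclideanSpace.single j 1)) 0

/-- The radial projection `x ↦ x / |x|` of `ℝⁿ ∖ {0}` onto the sphere
(the value at `x = 0` is irrelevant). -/
def radialProj [n.AtLeastTwo] (x : E n) : Sph n :=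
  if h : x = 0 then
    ⟨EuclideanSpace.single ⟨0, by have := Nat.AtLeastTwo.prop (n := n); omega⟩ 1, by simp⟩
  else ⟨‖x‖⁻¹ • x, by simp [norm_smul, h]⟩

/-- The Laplace–Beltrami operator `Δ_u` of `𝕊^{n-1}` in the variable `u`: the Laplacian at `u` of
the extension `x ↦ Φ(x / |x|, b, a)` of `Φ(·, b, a)` that is constant along rays. -/
def laplaceU [n.AtLeastTwo] (Φ : Y n → ℂ) : Y n → ℂ :=
  fun p => Laplacian.laplacian (fun x : E n => Φ (radialProj x, p.2.1, p.2.2)) (p.1 : E n)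

end Operators

instance finrankFact (n : ℕ) [n.AtLeastTwo] :
    Fact (Module.finrank ℝ (E n) = (n - 1) + 1) :=
  ⟨by have := Nat.AtLeastTwo.prop (n := n); rw [finrank_euclideanSpace_fin]; omega⟩

section Smooth

variable {n : ℕ}

/-- The domain `(ℝⁿ ∖ {0}) × ℝ × ℝⁿ`. -/
def dom (n : ℕ) : Set (E n × ℝ × E n) := {q | q.1 ≠ 0}

lemma isOpen_dom : IsOpen (dom n) := isOpen_ne_fun continuous_fst continuous_const

lemma sph_ne_zero (u : Sph n) : (u : E n) ≠ 0 := by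
  have h := u.2
  rw [mem_sphere_zero_iff_norm] at h
  intro h0
  simp [h0] at h

lemma coe_mem_dom (p : Y n) : ((p.1 : E n), p.2) ∈ dom n := sph_ne_zero p.1

variable [n.AtLeastTwo]

/-- Smoothness on the manifold `𝕐^{2n} = 𝕊^{n-1} × ℝ × ℝⁿ`. -/
def IsSmooth (Φ : Y n → ℂ) : Prop :=
  ContMDiff ((𝓡 (n - 1)).prod (𝓘(ℝ, ℝ).prod 𝓘(ℝ, E n))) 𝓘(ℝ, ℂ) ∞ Φ

/-- The extension of `Φ` to `ℝⁿ × ℝ × ℝⁿ` that is constant along rays in the first variable. -/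
def ext (Φ : Y n → ℂ) : E n × ℝ × E n → ℂ := fun q => Φ (radialProj q.1, q.2)

@[simp] lemma radialProj_coe (u : Sph n) : radialProj (u : E n) = u := by
  have h := u.2
  rw [mem_sphere_zero_iff_norm] at h
  rw [radialProj, dif_neg (sph_ne_zero u)]
  ext1
  simp [h]

lemma contMDiffAt_radialProj {x : E n} (hx : x ≠ 0) :
    ContMDiffAt 𝓘(ℝ, E n) (𝓡 (n - 1)) ∞ (radialProj : E n → Sph n) x := by
  let U : TopologicalSpace.Opens (E n) := ⟨{y | y ≠ 0}, isOpen_ne⟩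
  have h1 : ContMDiff 𝓘(ℝ, E n) 𝓘(ℝ, E n) ∞ (fun y : U => ‖(y : E n)‖⁻¹ • (y : E n)) := by
    intro y
    have h2 : ContDiffAt ℝ ∞ (fun y : E n => ‖y‖⁻¹ • y) (y : E n) :=
      ((contDiffAt_norm ℝ y.2).inv (norm_ne_zero_iff.2 y.2)).smul contDiffAt_id
    exact (contMDiffAt_subtype_iff (U := U)).2 h2.contMDiffAt
  have h2 : ∀ y : U, ‖(y : E n)‖⁻¹ • (y : E n) ∈ Metric.sphere (0 : E n) 1 := by
    intro y
    have : (y : E n) ≠ 0 := y.2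
    simp [norm_smul, this]
  have h3 := (h1.codRestrict_sphere (n := n - 1) h2) ⟨x, hx⟩
  refine (contMDiffAt_subtype_iff (U := U) (x := ⟨x, hx⟩)).1 ?_
  have h4 : (fun y : U => radialProj (y : E n)) =
      Set.codRestrict (fun y : U => ‖(y : E n)‖⁻¹ • (y : E n)) _ h2 := by
    funext y
    have : (y : E n) ≠ 0 := y.2
    ext1
    simp [radialProj, this]
  rw [h4]
  exact h3

lemma IsSmooth.ext {Φ : Y n → ℂ} (h : IsSmooth Φ) : ContDiffOn ℝ ∞ (ext Φ) (dom n) := by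
  intro q hq
  refine ContDiffAt.contDiffWithinAt ?_
  rw [← contMDiffAt_iff_contDiffAt]
  have h1 : ContMDiffAt 𝓘(ℝ, E n × ℝ × E n) (𝓡 (n - 1)) ∞
      (fun q : E n × ℝ × E n => radialProj q.1) q :=
    (contMDiffAt_radialProj hq).comp q (contDiff_fst.contMDiff q)
  have h2 : ContMDiffAt 𝓘(ℝ, E n × ℝ × E n) 𝓘(ℝ, ℝ) ∞ (fun q : E n × ℝ × E n => q.2.1) q :=
    (contDiff_fst.comp contDiff_snd).contMDiff q
  have h3 : ContMDiffAt 𝓘(ℝ, E n × ℝ × E n) 𝓘(ℝ, E n) ∞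
      (fun q : E n × ℝ × E n => q.2.2) q :=
    (contDiff_snd.comp contDiff_snd).contMDiff q
  exact (h (radialProj q.1, q.2)).comp q (h1.prodMk (h2.prodMk h3))

lemma IsSmooth.of_ambient {g : E n × ℝ × E n → ℂ} (h : ContDiffOn ℝ ∞ g (dom n)) :
    IsSmooth (fun p : Y n => g (p.1, p.2)) := by
  intro p
  have h1 : ContDiffAt ℝ ∞ g ((p.1 : E n), p.2) :=
    (h _ (coe_mem_dom p)).contDiffAt (isOpen_dom.mem_nhds (coe_mem_dom p))
  have h2 : ContMDiff ((𝓡 (n - 1)).prod (𝓘(ℝ, ℝ).prod 𝓘(ℝ, E n))) 𝓘(ℝ, E n) ∞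
      (fun p : Y n => (p.1 : E n)) := (contMDiff_coe_sphere (n := n - 1)).comp contMDiff_fst
  have h3 : ContMDiff ((𝓡 (n - 1)).prod (𝓘(ℝ, ℝ).prod 𝓘(ℝ, E n))) 𝓘(ℝ, ℝ × E n) ∞
      (fun p : Y n => p.2) := by
    have h4 : ContMDiff ((𝓡 (n - 1)).prod (𝓘(ℝ, ℝ).prod 𝓘(ℝ, E n))) 𝓘(ℝ, ℝ) ∞
      (fun p : Y n => p.2.1) := contMDiff_fst.comp contMDiff_snd
    have h5 : ContMDiff ((𝓡 (n - 1)).prod (𝓘(ℝ, ℝ).prod 𝓘(ℝ, E n))) 𝓘(ℝ, E n) ∞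
      (fun p : Y n => p.2.2) := contMDiff_snd.comp contMDiff_snd
    exact h4.prodMk_space h5
  exact ContMDiffAt.comp (I' := 𝓘(ℝ, E n × ℝ × E n)) p h1.contMDiffAt ((h2.prodMk_space h3) p)

lemma ext_coe (Φ : Y n → ℂ) (p : Y n) : ext Φ ((p.1 : E n), p.2) = Φ p := by
  simp [DSTFRFT.ext]

lemma contDiffOn_dir {g : E n × ℝ × E n → ℂ} (h : ContDiffOn ℝ ∞ g (dom n))
    (w : E n × ℝ × E n) : ContDiffOn ℝ ∞ (fun q => fderiv ℝ g q w) (dom n) :=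
  (h.fderiv_of_isOpen isOpen_dom (by simp)).clm_apply contDiffOn_const

lemma IsSmooth.differentiableAt {Φ : Y n → ℂ} (h : IsSmooth Φ) {q : E n × ℝ × E n}
    (hq : q ∈ dom n) : DifferentiableAt ℝ (DSTFRFT.ext Φ) q :=
  (h.ext.differentiableOn (by simp)).differentiableAt (isOpen_dom.mem_nhds hq)

lemma partialB_eq {Φ : Y n → ℂ} (h : IsSmooth Φ) (p : Y n) :
    partialB Φ p = fderiv ℝ (DSTFRFT.ext Φ) (p.1, p.2) (0, 1, 0) := by
  have h1 := (h.differentiableAt (coe_mem_dom p)).hasFDerivAt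
  have h2 : HasDerivAt (fun t : ℝ => (((p.1 : E n), t, p.2.2) : E n × ℝ × E n)) (0, 1, 0) p.2.1 :=
    (hasDerivAt_const _ _).prodMk ((hasDerivAt_id _).prodMk (hasDerivAt_const _ _))
  have h3 := (h1.comp_hasDerivAt p.2.1 h2).deriv
  rw [← h3, partialB]
  congr 1
  funext t
  exact (ext_coe Φ (p.1, t, p.2.2)).symm

lemma partialA_eq {Φ : Y n → ℂ} (h : IsSmooth Φ) (j : Fin n) (p : Y n) :
    partialA j Φ p =
      fderiv ℝ (DSTFRFT.ext Φ) (p.1, p.2) (0, 0, EuclideanSpace.single j 1) := by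
  have h1 := (h.differentiableAt (coe_mem_dom p)).hasFDerivAt
  have h2 : HasDerivAt (fun t : ℝ => (((p.1 : E n), p.2.1, p.2.2 +
      t • EuclideanSpace.single j (1 : ℝ)) : E n × ℝ × E n))
      (0, 0, EuclideanSpace.single j 1) 0 := by
    refine (hasDerivAt_const _ _).prodMk ((hasDerivAt_const _ _).prodMk ?_)
    simpa using ((hasDerivAt_id (0 : ℝ)).smul_const
      (EuclideanSpace.single j (1 : ℝ))).const_add p.2.2
  have h3 := (HasFDerivAt.comp_hasDerivAt_of_eq (0 : ℝ) h1 h2 (by simp)).deriv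
  rw [← h3, partialA]
  congr 1
  funext t
  exact (ext_coe Φ (p.1, p.2.1, p.2.2 + t • EuclideanSpace.single j 1)).symm

lemma contDiffAt_slice {g : E n × ℝ × E n → ℂ} (h : ContDiffOn ℝ ∞ g (dom n))
    {x : E n} (hx : x ≠ 0) (c : ℝ × E n) : ContDiffAt ℝ ∞ (fun y : E n => g (y, c)) x :=
  ContDiffAt.comp x ((h (x, c) hx).contDiffAt (isOpen_dom.mem_nhds hx))
    (contDiffAt_id.prodMk contDiffAt_const)

lemma fderiv_slice {g : E n × ℝ × E n → ℂ} (h : ContDiffOn ℝ ∞ g (dom n))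
    {x : E n} (hx : x ≠ 0) (c : ℝ × E n) (v : E n) :
    fderiv ℝ (fun y : E n => g (y, c)) x v = fderiv ℝ g (x, c) (v, 0) := by
  have h1 : HasFDerivAt g (fderiv ℝ g (x, c)) (x, c) :=
    (((h (x, c) hx).contDiffAt (isOpen_dom.mem_nhds hx)).differentiableAt (by simp)).hasFDerivAt
  have h2 : HasFDerivAt (fun y : E n => (y, c)) (.prod (.id ℝ (E n)) 0) x :=
    (hasFDerivAt_id x).prodMk (hasFDerivAt_const c x)
  have h3 : HasFDerivAt (fun y : E n => g (y, c)) _ x := HasFDerivAt.comp x h1 h2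
  rw [h3.fderiv]
  rfl

lemma laplaceU_eq {Φ : Y n → ℂ} (h : IsSmooth Φ) (p : Y n) :
    laplaceU Φ p = ∑ i, fderiv ℝ (fun q => fderiv ℝ (DSTFRFT.ext Φ) q
      (EuclideanSpace.basisFun (Fin n) ℝ i, 0)) (p.1, p.2)
        (EuclideanSpace.basisFun (Fin n) ℝ i, 0) := by
  rw [laplaceU, InnerProductSpace.laplacian_eq_iteratedFDeriv_orthonormalBasis _
    (EuclideanSpace.basisFun (Fin n) ℝ)]
  refine Finset.sum_congr rfl fun i _ => ?_
  set w := EuclideanSpace.basisFun (Fin n) ℝ i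
  rw [iteratedFDeriv_two_apply]
  change fderiv ℝ (fderiv ℝ (fun y => DSTFRFT.ext Φ (y, p.2))) (p.1 : E n) w w = _
  have hd : DifferentiableAt ℝ (fderiv ℝ (fun y => DSTFRFT.ext Φ (y, p.2))) (p.1 : E n) :=
    ((contDiffAt_slice h.ext (sph_ne_zero p.1) p.2).fderiv_right
      (m := 1) (by norm_cast)).differentiableAt (by simp)
  have h1 : fderiv ℝ (fun x => fderiv ℝ (fun y => DSTFRFT.ext Φ (y, p.2)) x w) (p.1 : E n) w =
      fderiv ℝ (fderiv ℝ (fun y => DSTFRFT.ext Φ (y, p.2))) (p.1 : E n) w w := by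
    rw [fderiv_clm_apply hd (differentiableAt_const w)]
    simp
  rw [← h1, ← fderiv_slice (contDiffOn_dir h.ext (w, 0)) (sph_ne_zero p.1) p.2 w]
  have h2 : (fun x => fderiv ℝ (fun y => DSTFRFT.ext Φ (y, p.2)) x w) =ᶠ[nhds (p.1 : E n)]
      fun y => fderiv ℝ (DSTFRFT.ext Φ) (y, p.2) (w, 0) := by
    filter_upwards [isOpen_ne.mem_nhds (sph_ne_zero p.1)] with y hy
    exact fderiv_slice h.ext hy p.2 w
  rw [h2.fderiv_eq]

lemma IsSmooth.partialB {Φ : Y n → ℂ} (h : IsSmooth Φ) : IsSmooth (partialB Φ) := by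
  rw [funext (partialB_eq h)]
  exact IsSmooth.of_ambient (contDiffOn_dir h.ext _)

lemma IsSmooth.partialA {Φ : Y n → ℂ} (h : IsSmooth Φ) (j : Fin n) : IsSmooth (partialA j Φ) := by
  rw [funext (partialA_eq h j)]
  exact IsSmooth.of_ambient (contDiffOn_dir h.ext _)

lemma IsSmooth.laplaceU {Φ : Y n → ℂ} (h : IsSmooth Φ) : IsSmooth (laplaceU Φ) := by
  rw [funext (laplaceU_eq h)]
  exact IsSmooth.of_ambient (g := fun q => ∑ i, fderiv ℝ (fun q => fderiv ℝ (DSTFRFT.ext Φ) q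
      (EuclideanSpace.basisFun (Fin n) ℝ i, 0)) q (EuclideanSpace.basisFun (Fin n) ℝ i, 0))
    (ContDiffOn.sum fun i _ => contDiffOn_dir (contDiffOn_dir h.ext _) _)

end Smooth

/-- The complex vector space `C^∞(𝕐^{2n})` of smooth complex-valued functions. -/
def smoothFun (n : ℕ) [n.AtLeastTwo] : Submodule ℂ (Y n → ℂ) where
  carrier := {Φ | IsSmooth Φ}
  add_mem' h1 h2 := ContMDiff.add h1 h2
  zero_mem' := contMDiff_const
  smul_mem' c _ h := ContDiff.comp_contMDiff (g := fun z : ℂ => c • z)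
    (contDiff_id.const_smul c) h

section Bundled

variable {n : ℕ} [n.AtLeastTwo]

lemma isSmooth (Φ : smoothFun n) : IsSmooth (Φ : Y n → ℂ) := Φ.2

/-- `∂_b` as an endomorphism of `C^∞(𝕐^{2n})`. -/
def opB : Module.End ℂ (smoothFun n) where
  toFun Φ := ⟨partialB Φ, IsSmooth.partialB (isSmooth Φ)⟩
  map_add' Φ Ψ := by
    ext p
    change partialB ((Φ + Ψ : smoothFun n) : Y n → ℂ) p = partialB Φ p + partialB Ψ p
    rw [partialB_eq (isSmooth (Φ + Ψ)), partialB_eq (isSmooth Φ), partialB_eq (isSmooth Ψ),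
      ← add_apply, ← fderiv_add (IsSmooth.differentiableAt (isSmooth Φ) (coe_mem_dom p))
        (IsSmooth.differentiableAt (isSmooth Ψ) (coe_mem_dom p))]
    rfl
  map_smul' c Φ := by
    ext p
    change partialB ((c • Φ : smoothFun n) : Y n → ℂ) p = c • partialB Φ p
    rw [partialB_eq (isSmooth (c • Φ)), partialB_eq (isSmooth Φ),
      ← smul_apply, ← fderiv_const_smul (IsSmooth.differentiableAt (isSmooth Φ) (coe_mem_dom p))]
    rfl

/-- `∂_{aⱼ}` as an endomorphism of `C^∞(𝕐^{2n})`. -/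
def opA (j : Fin n) : Module.End ℂ (smoothFun n) where
  toFun Φ := ⟨partialA j Φ, IsSmooth.partialA (isSmooth Φ) j⟩
  map_add' Φ Ψ := by
    ext p
    change partialA j ((Φ + Ψ : smoothFun n) : Y n → ℂ) p = partialA j Φ p + partialA j Ψ p
    rw [partialA_eq (isSmooth (Φ + Ψ)), partialA_eq (isSmooth Φ), partialA_eq (isSmooth Ψ),
      ← add_apply, ← fderiv_add (IsSmooth.differentiableAt (isSmooth Φ) (coe_mem_dom p))
        (IsSmooth.differentiableAt (isSmooth Ψ) (coe_mem_dom p))]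
    rfl
  map_smul' c Φ := by
    ext p
    change partialA j ((c • Φ : smoothFun n) : Y n → ℂ) p = c • partialA j Φ p
    rw [partialA_eq (isSmooth (c • Φ)), partialA_eq (isSmooth Φ),
      ← smul_apply, ← fderiv_const_smul (IsSmooth.differentiableAt (isSmooth Φ) (coe_mem_dom p))]
    rfl

/-- `Δ_u` as an endomorphism of `C^∞(𝕐^{2n})`. -/
def opU : Module.End ℂ (smoothFun n) where
  toFun Φ := ⟨laplaceU Φ, IsSmooth.laplaceU (isSmooth Φ)⟩
  map_add' Φ Ψ := by
    ext p
    exact ContDiffAt.laplacian_add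
      ((contDiffAt_slice (IsSmooth.ext (isSmooth Φ)) (sph_ne_zero p.1) p.2).of_le (by norm_cast))
      ((contDiffAt_slice (IsSmooth.ext (isSmooth Ψ)) (sph_ne_zero p.1) p.2).of_le (by norm_cast))
  map_smul' c Φ := by
    ext p
    exact InnerProductSpace.laplacian_smul c
      ((contDiffAt_slice (IsSmooth.ext (isSmooth Φ)) (sph_ne_zero p.1) p.2).of_le (by norm_cast))

/-- `∂_a^l = ∂_{a₁}^{l₁} ⋯ ∂_{aₙ}^{lₙ}` for a multi-index `l`. -/
def opMultiA (l : Fin n → ℕ) : Module.End ℂ (smoothFun n) :=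
  (List.ofFn fun j => opA j ^ l j).prod

/-- `∂_a^l ∂_b^m Δ_u^k`. -/
def opDiff (l : Fin n → ℕ) (m k : ℕ) : Module.End ℂ (smoothFun n) :=
  opMultiA l * opB ^ m * opU ^ k

end Bundled

/-! ### The space `𝒮(𝕐^{2n})` -/

/-- The indices of the seminorms `ρ_{s,r}^{l,m,k}`. -/
structure Index (n : ℕ) where
  s : ℕ
  r : ℕ
  l : Fin n → ℕ
  m : ℕ
  k : ℕ

/-- The function
`(1 + |b|²)^{r/2} (1 + |a|²)^{s/2} |∂_a^l ∂_b^m Δ_u^k Φ(u, b, a)|` whose supremum is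
`ρ_{s,r}^{l,m,k}(Φ)`. -/
def weighted {n : ℕ} [n.AtLeastTwo] (i : Index n) (Φ : smoothFun n) (p : Y n) : ℝ :=
  (1 + |p.2.1| ^ 2) ^ ((i.r : ℝ) / 2) * (1 + ‖p.2.2‖ ^ 2) ^ ((i.s : ℝ) / 2) *
    ‖(opDiff i.l i.m i.k Φ : Y n → ℂ) p‖

section Weighted

variable {n : ℕ} [n.AtLeastTwo]

lemma weighted_nonneg (i : Index n) (Φ : smoothFun n) (p : Y n) : 0 ≤ weighted i Φ p := by
  unfold weighted
  positivity

lemma weighted_add (i : Index n) (Φ Ψ : smoothFun n) (p : Y n) :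
    weighted i (Φ + Ψ) p ≤ weighted i Φ p + weighted i Ψ p := by
  unfold weighted
  rw [map_add, ← mul_add]
  exact mul_le_mul_of_nonneg_left (norm_add_le _ _) (by positivity)

lemma weighted_smul (i : Index n) (c : ℂ) (Φ : smoothFun n) (p : Y n) :
    weighted i (c • Φ) p = ‖c‖ * weighted i Φ p := by
  have h : ‖(opDiff i.l i.m i.k (c • Φ) : Y n → ℂ) p‖ =
      ‖c‖ * ‖(opDiff i.l i.m i.k Φ : Y n → ℂ) p‖ := by
    rw [map_smul]
    exact norm_smul c _
  unfold weighted
  rw [h]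
  ring

end Weighted

/-- The smooth functions all of whose seminorms `ρ_{s,r}^{l,m,k}` are finite. -/
def schwartzSubmodule (n : ℕ) [n.AtLeastTwo] : Submodule ℂ (smoothFun n) where
  carrier := {Φ | ∀ i : Index n, BddAbove (Set.range (weighted i Φ))}
  add_mem' := by
    intro Φ Ψ h1 h2 i
    obtain ⟨A, hA⟩ := h1 i
    obtain ⟨B, hB⟩ := h2 i
    refine ⟨A + B, ?_⟩
    rintro _ ⟨p, rfl⟩
    exact (weighted_add i Φ Ψ p).trans (add_le_add (hA ⟨p, rfl⟩) (hB ⟨p, rfl⟩))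
  zero_mem' := by
    intro i
    refine ⟨0, ?_⟩
    rintro _ ⟨p, rfl⟩
    simp [weighted]
  smul_mem' := by
    intro c Φ h i
    obtain ⟨A, hA⟩ := h i
    refine ⟨‖c‖ * A, ?_⟩
    rintro _ ⟨p, rfl⟩
    rw [weighted_smul]
    exact mul_le_mul_of_nonneg_left (hA ⟨p, rfl⟩) (norm_nonneg c)

/-- The space `𝒮(𝕐^{2n})`. -/
def SchwartzY (n : ℕ) [n.AtLeastTwo] : Type := schwartzSubmodule n

namespace SchwartzY

variable {n : ℕ} [n.AtLeastTwo]

instance : AddCommGroup (SchwartzY n) := inferInstanceAs (AddCommGroup (schwartzSubmodule n))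

instance : Module ℂ (SchwartzY n) := inferInstanceAs (Module ℂ (schwartzSubmodule n))

/-- The underlying smooth function. -/
def toSmooth (Φ : SchwartzY n) : smoothFun n := Φ.1

instance : CoeFun (SchwartzY n) fun _ => Y n → ℂ := ⟨fun Φ => Φ.toSmooth.1⟩

/-- The seminorm `ρ_{s,r}^{l,m,k}` on `𝒮(𝕐^{2n})`. -/
def rho (i : Index n) : Seminorm ℂ (SchwartzY n) :=
  Seminorm.of (fun Φ => ⨆ p, weighted i Φ.toSmooth p)
    (fun Φ Ψ => Real.iSup_le
      (fun p => (weighted_add i Φ.toSmooth Ψ.toSmooth p).trans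
        (add_le_add (le_ciSup (Φ.2 i) p) (le_ciSup (Ψ.2 i) p)))
      (add_nonneg (Real.iSup_nonneg (weighted_nonneg i _))
        (Real.iSup_nonneg (weighted_nonneg i _))))
    (fun c Φ => by
      rw [Real.mul_iSup_of_nonneg (norm_nonneg c)]
      exact iSup_congr (weighted_smul i c Φ.toSmooth))

/-- The family of seminorms `ρ_{s,r}^{l,m,k}`. -/
def rhoFamily (n : ℕ) [n.AtLeastTwo] : SeminormFamily ℂ (SchwartzY n) (Index n) := rho

instance : Nonempty (Index n) := ⟨⟨0, 0, 0, 0, 0⟩⟩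

/-- The topology of `𝒮(𝕐^{2n})` is generated by the seminorms `ρ_{s,r}^{l,m,k}`. -/
instance : TopologicalSpace (SchwartzY n) := (rhoFamily n).moduleFilterBasis.topology

lemma withSeminorms : WithSeminorms (rhoFamily n) := ⟨rfl⟩

end SchwartzY

/-! ### The synthesis operator -/

/-- The integrand `Φ(u, b, a) ψ(x · u - b) K_{-α}(x, a)`. -/
def synthIntegrand {n : ℕ} (α : Fin n → ℝ) (Φ : Y n → ℂ) (ψ : ℝ → ℂ) (x : E n) (p : Y n) : ℂ :=
  Φ p * ψ (inner ℝ x (p.1 : E n) - p.2.1) * kernel (-α) x p.2.2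

/-- The directional short-time fractional Fourier synthesis operator
`(DS_ψ^α)^* Φ(x) = ∫_{𝕊^{n-1}} ∫_{ℝⁿ} ∫_ℝ Φ(u, b, a) ψ(x · u - b) K_{-α}(x, a) db da du`. -/
def synthesis {n : ℕ} (α : Fin n → ℝ) (Φ : Y n → ℂ) (ψ : ℝ → ℂ) (x : E n) : ℂ :=
  ∫ u : Sph n, (∫ a : E n, ∫ b : ℝ, synthIntegrand α Φ ψ x (u, b, a)) ∂(sphereMeasure n)

end DSTFRFT

end

noncomputable section

namespace DSTFRFT

section Operators

variable {n : ℕ}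

/-! The kernel has constant modulus, so absolute convergence comes from the decay of `Φ` in `(b, a)`
together with the boundedness of `ψ`. The difficulty is the variable `x`: the kernel does not decay
in `x`, and each `x`-derivative produces a factor growing linearly in `x`. Both problems disappear
because `x` can be traded for operations on `Φ`.

With `β = -α`, `∂_{aⱼ} K_β = i (aⱼ cot βⱼ - xⱼ csc βⱼ) K_β`, while `ψ(x · u - b)` does not involve
`a`. Integrating by parts in `a` therefore gives `xⱼ S(Φ, ψ) = S(Xⱼ Φ, ψ)` with `Xⱼ = cos βⱼ aⱼ - i
sin βⱼ ∂_{aⱼ}` (`synth_mulX`). Differentiating under the integral and absorbing the resulting factor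
`xⱼ` in the same way gives `∂ⱼ S(Φ, ψ) = S(uⱼ Φ, ψ') + S(Dⱼ Φ, ψ)`, where `Dⱼ` is a combination of
`Xⱼ` and `aⱼ` (`hasFDerivAt_synth`). By induction, every `x^k ∂^m S(Φ, ψ)` is controlled by sup
bounds on finitely many terms `S(Φ', ψ')` (`controlled_pow_mul_norm_iteratedFDeriv`).

The inductions run in the class `Rapid`, which involves only `a`-derivatives, rather than in
`𝒮(𝕐^{2n})`: the seminorms with `m = k = 0` and `r = 2` suffice, and commutators of `uⱼ` with `Δ_u`
never occur. The constant `A` in `DecayBound` is carried linearly through all estimates. Choosing it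
as a continuous seminorm of `Φ` bounds each output seminorm by a product `q Φ * r ψ`, which gives
joint continuity. -/

lemma abs_apply_le_norm (x : E n) (j : Fin n) : |x j| ≤ ‖x‖ := by
  simpa using PiLp.norm_apply_le x j

lemma norm_le_sum_abs (x : E n) : ‖x‖ ≤ ∑ j, |x j| := by
  rw [EuclideanSpace.norm_eq]
  refine Real.sqrt_le_iff.2 ⟨Finset.sum_nonneg fun _ _ => abs_nonneg _, ?_⟩
  exact Finset.sum_sq_le_sq_sum_of_nonneg fun _ _ => abs_nonneg _

variable [n.AtLeastTwo]

/-! ### Operators on smooth functions -/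

@[simp] lemma smoothFun_add_apply (Φ Ψ : smoothFun n) (p : Y n) :
    ((Φ + Ψ : smoothFun n) : Y n → ℂ) p = (Φ : Y n → ℂ) p + (Ψ : Y n → ℂ) p := rfl

@[simp] lemma smoothFun_smul_apply (c : ℂ) (Φ : smoothFun n) (p : Y n) :
    ((c • Φ : smoothFun n) : Y n → ℂ) p = c * (Φ : Y n → ℂ) p := rfl

lemma smoothFun_continuous (Φ : smoothFun n) : Continuous (Φ : Y n → ℂ) :=
  ContMDiff.continuous (isSmooth Φ)

/-- Multiplication by `g(u, b, a)`, for `g` smooth on the ambient space. -/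
def mulOp (g : E n × ℝ × E n → ℂ) (hg : ContDiff ℝ ∞ g) : Module.End ℂ (smoothFun n) where
  toFun Φ := ⟨fun p => g (p.1, p.2) * (Φ : Y n → ℂ) p, by
    -- Smoothness is checked on the ambient product of `g` with the radial extension of `Φ`, which
    -- restricts to `g Φ` on the sphere.
    have h := IsSmooth.of_ambient (hg.contDiffOn.mul (isSmooth Φ).ext)
    simp only [ext_coe] at h
    exact h⟩
  map_add' Φ Ψ := by
    ext p
    exact mul_add _ _ _
  map_smul' c Φ := by
    ext p
    exact mul_left_comm _ _ _

/-- Multiplication by `uⱼ`. -/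
def mulU (j : Fin n) : Module.End ℂ (smoothFun n) :=
  mulOp (fun q => ((q.1 j : ℝ) : ℂ))
    (Complex.ofRealCLM.contDiff.comp ((EuclideanSpace.proj (𝕜 := ℝ) j).contDiff.comp contDiff_fst))

/-- Multiplication by `aⱼ`. -/
def mulA (j : Fin n) : Module.End ℂ (smoothFun n) :=
  mulOp (fun q => ((q.2.2 j : ℝ) : ℂ))
    (Complex.ofRealCLM.contDiff.comp ((EuclideanSpace.proj (𝕜 := ℝ) j).contDiff.comp
      (contDiff_snd.comp contDiff_snd)))

lemma mulU_apply (j : Fin n) (Φ : smoothFun n) (p : Y n) :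
    (mulU j Φ : Y n → ℂ) p = (((p.1 : E n) j : ℝ) : ℂ) * (Φ : Y n → ℂ) p := rfl

lemma mulA_apply (j : Fin n) (Φ : smoothFun n) (p : Y n) :
    (mulA j Φ : Y n → ℂ) p = ((p.2.2 j : ℝ) : ℂ) * (Φ : Y n → ℂ) p := rfl

/-- Reduces `∂_{aⱼ}` to Fréchet derivatives on `ℝⁿ` with `(u, b)` frozen, so that no manifold
calculus is needed from here on. -/
lemma contDiff_slice_a (Φ : smoothFun n) (u : Sph n) (b : ℝ) :
    ContDiff ℝ ∞ (fun a : E n => (Φ : Y n → ℂ) (u, b, a)) := by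
  have h : (fun a : E n => (Φ : Y n → ℂ) (u, b, a)) =
      fun a : E n => DSTFRFT.ext (Φ : Y n → ℂ) ((u : E n), b, a) := by
    funext a
    exact (ext_coe (Φ : Y n → ℂ) (u, b, a)).symm
  rw [h, contDiff_iff_contDiffAt]
  intro a
  have h1 : ContDiffAt ℝ ∞ (DSTFRFT.ext (Φ : Y n → ℂ)) ((u : E n), b, a) :=
    ((isSmooth Φ).ext _ (coe_mem_dom (u, b, a))).contDiffAt
      (isOpen_dom.mem_nhds (coe_mem_dom (u, b, a)))
  have h2 : ContDiffAt ℝ ∞ (fun a : E n => ((u : E n), b, a)) a :=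
    contDiffAt_const.prodMk (contDiffAt_const.prodMk contDiffAt_id)
  exact ContDiffAt.comp (g := DSTFRFT.ext (Φ : Y n → ℂ)) a h1 h2

lemma opA_apply (j : Fin n) (Φ : smoothFun n) (p : Y n) :
    (opA j Φ : Y n → ℂ) p =
      fderiv ℝ (fun a : E n => (Φ : Y n → ℂ) (p.1, p.2.1, a)) p.2.2
        (EuclideanSpace.single j 1) :=
  (((contDiff_slice_a Φ p.1 p.2.1).differentiable (by simp)) p.2.2).lineDeriv_eq_fderiv

lemma hasDerivAt_opA (j : Fin n) (Φ : smoothFun n) (p : Y n) :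
    HasDerivAt (fun t : ℝ => (Φ : Y n → ℂ)
      (p.1, p.2.1, p.2.2 + t • EuclideanSpace.single j (1 : ℝ))) ((opA j Φ : Y n → ℂ) p) 0 := by
  have h := (((contDiff_slice_a Φ p.1 p.2.1).differentiable (by simp))
    p.2.2).hasFDerivAt.hasLineDerivAt (EuclideanSpace.single j (1 : ℝ))
  rw [opA_apply]
  exact h

/-- Symmetry of the second derivative of the slice in `a`. -/
lemma opA_commute (i j : Fin n) : Commute (opA i : Module.End ℂ (smoothFun n)) (opA j) := by
  refine LinearMap.ext fun Φ => ?_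
  ext p
  have hc := contDiff_slice_a Φ p.1 p.2.1
  have key : ∀ i j : Fin n, (opA i (opA j Φ) : Y n → ℂ) p =
      fderiv ℝ (fderiv ℝ (fun a : E n => (Φ : Y n → ℂ) (p.1, p.2.1, a))) p.2.2
        (EuclideanSpace.single i 1) (EuclideanSpace.single j 1) := by
    intro i j
    rw [opA_apply, funext fun a : E n => opA_apply j Φ (p.1, p.2.1, a)]
    have hd : DifferentiableAt ℝ
        (fderiv ℝ (fun a : E n => (Φ : Y n → ℂ) (p.1, p.2.1, a))) p.2.2 :=
      ((hc.fderiv_right (m := 1) (by norm_cast)).differentiable (by simp)) p.2.2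
    rw [fderiv_clm_apply hd (differentiableAt_const _)]
    simp
  have hs : IsSymmSndFDerivAt ℝ (fun a : E n => (Φ : Y n → ℂ) (p.1, p.2.1, a)) p.2.2 :=
    hc.contDiffAt.isSymmSndFDerivAt
      (by rw [minSmoothness_of_isRCLikeNormedField]; exact WithTop.coe_le_coe.2 le_top)
  exact (key i j).trans ((hs _ _).trans (key j i).symm)

/-- The monoid is not commutative, so the new factor is moved past the preceding powers one at a
time until it reaches the `j`-th. This lets the words in the `∂_{aⱼ}` used by `DecayBound` be
rewritten as multi-index derivatives. -/
lemma mul_prod_ofFn_pow {M : Type*} [Monoid M] {d : ℕ} (f : Fin d → M)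
    (hf : ∀ i j, Commute (f i) (f j)) (l : Fin d → ℕ) (j : Fin d) :
    f j * (List.ofFn fun i => f i ^ l i).prod =
      (List.ofFn fun i => f i ^ (l i + (Pi.single j 1 : Fin d → ℕ) i)).prod := by
  induction d with
  | zero => exact j.elim0
  | succ d ih =>
    rw [List.ofFn_succ, List.ofFn_succ, List.prod_cons, List.prod_cons]
    refine Fin.cases ?_ (fun j => ?_) j
    · rw [← mul_assoc, ← pow_succ']
      simp
    · rw [← mul_assoc, ((hf _ _).pow_right _).eq, mul_assoc,
        ih (fun i => f i.succ) (fun i j => hf _ _) (fun i => l i.succ) j]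
      simp [Pi.single_apply]

lemma opA_opMultiA (j : Fin n) (l : Fin n → ℕ) (Φ : smoothFun n) :
    opA j (opMultiA l Φ) = opMultiA (l + Pi.single j 1) Φ :=
  LinearMap.congr_fun (mul_prod_ofFn_pow (fun j => (opA j : Module.End ℂ (smoothFun n)))
    opA_commute l j) Φ

/-! ### Rapidly decreasing functions -/

/-- All iterated `a`-derivatives of `Φ` of order at most `L` are bounded by
`A (1 + b²)⁻¹ (1 + |a|²)⁻ᴺ`. -/
def DecayBound : ℕ → ℕ → ℝ → smoothFun n → Prop
  | 0, N, A, Φ => ∀ p : Y n, (1 + p.2.1 ^ 2) * (1 + ‖p.2.2‖ ^ 2) ^ N * ‖(Φ : Y n → ℂ) p‖ ≤ A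
  | L + 1, N, A, Φ => DecayBound L N A Φ ∧ ∀ j, DecayBound L N A (opA j Φ)

lemma DecayBound.mono {L L' N N' : ℕ} {A A' : ℝ} {Φ : smoothFun n} (h : DecayBound L N A Φ)
    (hL : L' ≤ L) (hN : N' ≤ N) (hA : A ≤ A') : DecayBound L' N' A' Φ := by
  induction L generalizing L' Φ with
  | zero =>
    obtain rfl : L' = 0 := by omega
    intro p
    refine le_trans ?_ ((h p).trans hA)
    have : (1 : ℝ) ≤ 1 + ‖p.2.2‖ ^ 2 := by nlinarith [sq_nonneg ‖p.2.2‖]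
    gcongr
  | succ L ih =>
    cases L' with
    | zero => exact ih h.1 (Nat.zero_le _)
    | succ L' => exact ⟨ih h.1 (by omega), fun j => ih (h.2 j) (by omega)⟩

lemma DecayBound.add {L N : ℕ} {A B : ℝ} {Φ Ψ : smoothFun n} (h : DecayBound L N A Φ)
    (h' : DecayBound L N B Ψ) : DecayBound L N (A + B) (Φ + Ψ) := by
  induction L generalizing Φ Ψ with
  | zero =>
    intro p
    refine le_trans ?_ (add_le_add (h p) (h' p))
    rw [← mul_add]
    exact mul_le_mul_of_nonneg_left (norm_add_le _ _) (by positivity)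
  | succ L ih =>
    refine ⟨ih h.1 h'.1, fun j => ?_⟩
    rw [map_add]
    exact ih (h.2 j) (h'.2 j)

lemma DecayBound.smul {L N : ℕ} {A : ℝ} {Φ : smoothFun n} (h : DecayBound L N A Φ) (c : ℂ) :
    DecayBound L N (‖c‖ * A) (c • Φ) := by
  induction L generalizing Φ with
  | zero =>
    intro p
    rw [smoothFun_smul_apply, norm_mul, mul_left_comm]
    exact mul_le_mul_of_nonneg_left (h p) (norm_nonneg c)
  | succ L ih =>
    refine ⟨ih h.1, fun j => ?_⟩
    rw [map_smul]
    exact ih (h.2 j)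

lemma DecayBound.nonneg {L N : ℕ} {A : ℝ} {Φ : smoothFun n} (h : DecayBound L N A Φ) : 0 ≤ A :=
  (by positivity : (0 : ℝ) ≤ _).trans
    ((h.mono (Nat.zero_le L) le_rfl le_rfl) (radialProj 0, 0, 0))

lemma opA_mulU (i j : Fin n) (Φ : smoothFun n) : opA i (mulU j Φ) = mulU j (opA i Φ) := by
  ext p
  exact (hasDerivAt_opA i (mulU j Φ) p).unique
    ((hasDerivAt_opA i Φ p).const_mul (((p.1 : E n) j : ℝ) : ℂ))

/-- The commutation relation `[∂_{aᵢ}, aⱼ] = δᵢⱼ`. -/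
lemma opA_mulA (i j : Fin n) (Φ : smoothFun n) :
    opA i (mulA j Φ) = mulA j (opA i Φ) + (if i = j then (1 : ℂ) else 0) • Φ := by
  ext p
  refine (hasDerivAt_opA i (mulA j Φ) p).unique ?_
  have h1 : HasDerivAt (fun t : ℝ =>
      (((p.2.2 + t • EuclideanSpace.single i (1 : ℝ)) j : ℝ) : ℂ))
      (if i = j then (1 : ℂ) else 0) 0 := by
    have h2 : HasDerivAt (fun t : ℝ => p.2.2 j + t * (if i = j then (1 : ℝ) else 0))
        (if i = j then (1 : ℝ) else 0) 0 := by
      simpa using ((hasDerivAt_id (0 : ℝ)).mul_const (if i = j then (1 : ℝ) else 0)).const_add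
        (p.2.2 j)
    convert h2.ofReal_comp using 1
    · funext t
      simp [eq_comm]
    · split_ifs <;> simp
  have h2 := h1.mul (hasDerivAt_opA i Φ p)
  have h3 : (mulA j (opA i Φ) + (if i = j then (1 : ℂ) else 0) • Φ : Y n → ℂ) p =
      (if i = j then (1 : ℂ) else 0) * (Φ : Y n → ℂ)
        (p.1, p.2.1, p.2.2 + (0 : ℝ) • EuclideanSpace.single i (1 : ℝ)) +
      (((p.2.2 + (0 : ℝ) • EuclideanSpace.single i (1 : ℝ)) j : ℝ) : ℂ) *
        (opA i Φ : Y n → ℂ) p := by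
    simp only [zero_smul, add_zero]
    exact add_comm _ _
  change HasDerivAt _ ((mulA j (opA i Φ) + (if i = j then (1 : ℂ) else 0) • Φ : Y n → ℂ) p) 0
  rw [h3]
  exact h2

lemma DecayBound.mulU {L N : ℕ} {A : ℝ} {Φ : smoothFun n} (h : DecayBound L N A Φ) (j : Fin n) :
    DecayBound L N A (mulU j Φ) := by
  induction L generalizing Φ with
  | zero =>
    intro p
    refine le_trans ?_ (h p)
    refine mul_le_mul_of_nonneg_left ?_ (by positivity)
    rw [mulU_apply, norm_mul]
    refine mul_le_of_le_one_left (norm_nonneg _) ?_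
    have := abs_apply_le_norm (p.1 : E n) j
    simpa using this
  | succ L ih =>
    refine ⟨ih h.1, fun i => ?_⟩
    rw [opA_mulU]
    exact ih (h.2 i)

/-- One power of the weight pays for `|aⱼ| ≤ 1 + |a|²`. Each derivative contributes at most one
commutator term, itself bounded by `A`, whence the factor `L + 1`. -/
lemma DecayBound.mulA {L N : ℕ} {A : ℝ} {Φ : smoothFun n} (h : DecayBound L (N + 1) A Φ)
    (j : Fin n) : DecayBound L N ((L + 1) * A) (mulA j Φ) := by
  induction L generalizing Φ with
  | zero =>
    intro p
    simp only [Nat.cast_zero, zero_add, one_mul]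
    refine le_trans ?_ (h p)
    rw [mulA_apply, norm_mul, pow_succ _ N, ← mul_assoc, ← mul_assoc]
    have h1 : ‖((p.2.2 j : ℝ) : ℂ)‖ ≤ 1 + ‖p.2.2‖ ^ 2 := by
      rw [Complex.norm_real, norm_eq_abs]
      nlinarith [abs_apply_le_norm p.2.2 j, sq_nonneg (‖p.2.2‖ - 1)]
    gcongr
  | succ L ih =>
    have hA := h.nonneg
    refine ⟨(ih h.1).mono le_rfl le_rfl ?_, fun i => ?_⟩
    · push_cast
      nlinarith
    · rw [opA_mulA]
      refine ((ih (h.2 i)).add ((h.1.mono le_rfl (Nat.le_succ N) le_rfl).smul _)).mono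
        le_rfl le_rfl ?_
      push_cast
      split_ifs <;> simp <;> nlinarith

/-- Operators bounded with respect to the scale of conditions `DecayBound`. -/
def Tame (X : Module.End ℂ (smoothFun n)) : Prop :=
  ∀ N : ℕ, ∃ N' : ℕ, ∃ C : ℝ, ∀ Φ A, DecayBound N' N' A Φ → DecayBound N N (C * A) (X Φ)

lemma tame_mulU (j : Fin n) : Tame (mulU j) := fun N =>
  ⟨N, 1, fun _ _ h => (h.mulU j).mono le_rfl le_rfl (one_mul _).ge⟩

lemma tame_mulA (j : Fin n) : Tame (mulA j) := fun N =>
  ⟨N + 1, N + 1, fun _ _ h => (h.mono (Nat.le_succ N) le_rfl le_rfl).mulA j⟩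

lemma tame_opA (j : Fin n) : Tame (opA j) := fun N =>
  ⟨N + 1, 1, fun _ _ h => (h.2 j).mono le_rfl (Nat.le_succ N) (one_mul _).ge⟩

lemma Tame.add {X X' : Module.End ℂ (smoothFun n)} (h : Tame X) (h' : Tame X') :
    Tame (X + X') := by
  intro N
  obtain ⟨N₁, C₁, h₁⟩ := h N
  obtain ⟨N₂, C₂, h₂⟩ := h' N
  refine ⟨max N₁ N₂, C₁ + C₂, fun Φ A hA => ?_⟩
  rw [add_mul]
  exact (h₁ Φ A (hA.mono (le_max_left _ _) (le_max_left _ _) le_rfl)).add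
    (h₂ Φ A (hA.mono (le_max_right _ _) (le_max_right _ _) le_rfl))

lemma Tame.smul {X : Module.End ℂ (smoothFun n)} (h : Tame X) (c : ℂ) : Tame (c • X) := by
  intro N
  obtain ⟨N', C, h⟩ := h N
  refine ⟨N', ‖c‖ * C, fun Φ A hA => ?_⟩
  rw [mul_assoc]
  exact (h Φ A hA).smul c

/-- `Φ` and all its `a`-derivatives decay rapidly in `a`, and like `(1 + b²)⁻¹` in `b`. -/
def Rapid (Φ : smoothFun n) : Prop := ∀ N : ℕ, ∃ A : ℝ, DecayBound N N A Φ

lemma Rapid.apply {X : Module.End ℂ (smoothFun n)} (hX : Tame X) {Φ : smoothFun n}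
    (h : Rapid Φ) : Rapid (X Φ) := by
  intro N
  obtain ⟨N', C, hC⟩ := hX N
  obtain ⟨A, hA⟩ := h N'
  exact ⟨C * A, hC Φ A hA⟩

lemma Rapid.add {Φ Ψ : smoothFun n} (h : Rapid Φ) (h' : Rapid Ψ) : Rapid (Φ + Ψ) := fun N =>
  let ⟨A, hA⟩ := h N
  let ⟨B, hB⟩ := h' N
  ⟨A + B, hA.add hB⟩

lemma Rapid.smul {Φ : smoothFun n} (h : Rapid Φ) (c : ℂ) : Rapid (c • Φ) := fun N =>
  let ⟨A, hA⟩ := h N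
  ⟨‖c‖ * A, hA.smul c⟩

/-! ### Decay bounds from the seminorms of `𝒮(𝕐^{2n})` -/

lemma weighted_opMultiA_le (l : Fin n → ℕ) (N : ℕ) (Φ : SchwartzY n) (p : Y n) :
    (1 + p.2.1 ^ 2) * (1 + ‖p.2.2‖ ^ 2) ^ N * ‖(opMultiA l Φ.toSmooth : Y n → ℂ) p‖ ≤
      SchwartzY.rho ⟨2 * N, 2, l, 0, 0⟩ Φ := by
  refine le_trans (le_of_eq ?_) (le_ciSup (Φ.2 ⟨2 * N, 2, l, 0, 0⟩) p)
  simp [weighted, opDiff, SchwartzY.toSmooth]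

lemma exists_decayBound (L N : ℕ) (l : Fin n → ℕ) :
    ∃ q : Seminorm ℂ (SchwartzY n), Continuous q ∧
      ∀ Φ : SchwartzY n, DecayBound L N (q Φ) (opMultiA l Φ.toSmooth) := by
  induction L generalizing l with
  | zero =>
    exact ⟨_, SchwartzY.withSeminorms.continuous_seminorm ⟨2 * N, 2, l, 0, 0⟩,
      fun Φ p => weighted_opMultiA_le l N Φ p⟩
  | succ L ih =>
    choose q hq hb using ih
    -- The first term serves the function itself, the sum its first `a`-derivatives.
    refine ⟨q l + ∑ j, q (l + Pi.single j 1), ?_, fun Φ => ⟨?_, fun j => ?_⟩⟩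
    · have : ⇑(q l + ∑ j, q (l + Pi.single j 1)) =
          fun Φ => q l Φ + ∑ j, q (l + Pi.single j 1) Φ := by
        funext Φ
        simp
      rw [this]
      exact (hq l).add (continuous_finsetSum _ fun j _ => hq _)
    · refine (hb l Φ).mono le_rfl le_rfl ?_
      rw [add_apply]
      exact le_add_of_nonneg_right (apply_nonneg _ _)
    · rw [opA_opMultiA]
      refine (hb _ Φ).mono le_rfl le_rfl ?_
      have h1 : q (l + Pi.single j 1) Φ ≤ ∑ j, q (l + Pi.single j 1) Φ :=
        Finset.single_le_sum (f := fun j => q (l + Pi.single j 1) Φ)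
          (fun j _ => apply_nonneg _ _) (Finset.mem_univ j)
      have h2 := apply_nonneg (q l) Φ
      have h3 : (q l + ∑ j, q (l + Pi.single j 1)) Φ =
        q l Φ + ∑ j, q (l + Pi.single j 1) Φ := by simp
      linarith

lemma exists_decayBound_toSmooth (N : ℕ) : ∃ q : Seminorm ℂ (SchwartzY n), Continuous q ∧
    ∀ Φ : SchwartzY n, DecayBound N N (q Φ) Φ.toSmooth := by
  obtain ⟨q, hq, h⟩ := exists_decayBound (n := n) N N 0
  refine ⟨q, hq, fun Φ => ?_⟩
  have h0 : (opMultiA 0 : Module.End ℂ (smoothFun n)) = 1 := by simp [opMultiA]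
  have := h Φ
  rwa [h0] at this

lemma rapid_toSmooth (Φ : SchwartzY n) : Rapid Φ.toSmooth := fun N =>
  let ⟨q, _, h⟩ := exists_decayBound_toSmooth (n := n) N
  ⟨q Φ, h Φ⟩

end Operators

/-! ### The kernel -/

section Kernel

variable {n : ℕ}

/-- The phase of the kernel. -/
def phase (α : Fin n → ℝ) (x a : E n) : ℝ :=
  ∑ k, ((x k ^ 2 + a k ^ 2) / 2 * Real.cot (α k) - x k * a k * (1 / Real.sin (α k)))

/-- The constant factor of the kernel. -/
def kernelConst (α : Fin n → ℝ) : ℂ :=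
  ∏ k, ((1 - Complex.I * (Real.cot (α k) : ℂ)) / (2 * (π : ℂ))) ^ (1 / 2 : ℂ)

lemma kernel_eq (α : Fin n → ℝ) (x a : E n) :
    kernel α x a = kernelConst α * Complex.exp (Complex.I * (phase α x a : ℂ)) := by
  simp only [kernel, kernel1, kernelConst, phase, Finset.prod_mul_distrib, ← Complex.exp_sum,
    ← Finset.mul_sum, Complex.ofReal_sum]

/-- The phase is real, so the exponential has modulus one. -/
lemma norm_kernel (α : Fin n → ℝ) (x a : E n) : ‖kernel α x a‖ = ‖kernelConst α‖ := by
  rw [kernel_eq, norm_mul, mul_comm Complex.I, Complex.norm_exp_ofReal_mul_I, mul_one]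

lemma phase_comm (α : Fin n → ℝ) (x a : E n) : phase α x a = phase α a x := by
  simp only [phase]
  exact Finset.sum_congr rfl fun k _ => by ring

lemma kernel_comm (α : Fin n → ℝ) (x a : E n) : kernel α x a = kernel α a x := by
  rw [kernel_eq, kernel_eq, phase_comm]

lemma continuous_kernel (α : Fin n → ℝ) (x : E n) : Continuous (kernel α x) := by
  have : Continuous (phase α x) := by
    unfold phase
    fun_prop
  rw [funext (kernel_eq α x)]
  fun_prop

/-! ### Derivatives of the kernel and of the translated window -/

/-- The covector `z ⊗ dxⱼ`, as a function of `z`. -/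
def coordForm (j : Fin n) : ℂ →L[ℝ] E n →L[ℝ] ℂ :=
  ContinuousLinearMap.smulRightL ℝ (E n) ℂ (EuclideanSpace.proj j)

@[simp] lemma coordForm_apply (j : Fin n) (z : ℂ) (v : E n) : coordForm j z v = v j * z := by
  simp [coordForm]

lemma hasFDerivAt_phase (α : Fin n → ℝ) (x a : E n) :
    HasFDerivAt (fun y => phase α y a)
      (∑ k, (x k * Real.cot (α k) - a k * (1 / Real.sin (α k))) •
        (EuclideanSpace.proj k : E n →L[ℝ] ℝ)) x := by
  refine HasFDerivAt.fun_sum fun k _ => ?_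
  have h : HasFDerivAt (fun y : E n => y k) (EuclideanSpace.proj k : E n →L[ℝ] ℝ) x :=
    (EuclideanSpace.proj k : E n →L[ℝ] ℝ).hasFDerivAt
  have h1 : HasDerivAt (fun t : ℝ => (t ^ 2 + a k ^ 2) / 2 * Real.cot (α k) -
      t * a k * (1 / Real.sin (α k)))
      (x k * Real.cot (α k) - a k * (1 / Real.sin (α k))) (x k) := by
    have := ((((hasDerivAt_pow 2 (x k)).add_const (a k ^ 2)).div_const 2).mul_const
      (Real.cot (α k))).sub (((hasDerivAt_id (x k)).mul_const (a k)).mul_const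
      (1 / Real.sin (α k)))
    refine this.congr_deriv ?_
    simp
  exact h1.comp_hasFDerivAt x h

lemma hasFDerivAt_kernel (α : Fin n → ℝ) (x a : E n) :
    HasFDerivAt (fun y => kernel α y a)
      (∑ k, coordForm k (Complex.I * ((x k * Real.cot (α k) - a k * (1 / Real.sin (α k)) : ℝ) : ℂ)
        * kernel α x a)) x := by
  have h1 := (((Complex.ofRealCLM.hasFDerivAt.comp x (hasFDerivAt_phase α x a)).const_mul
    Complex.I).cexp).const_mul (kernelConst α)
  rw [funext fun y => kernel_eq α y a, kernel_eq]
  refine h1.congr_fderiv ?_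
  ext v
  simp only [smul_apply, ContinuousLinearMap.comp_apply,
    sum_apply, smul_eq_mul, map_sum, coordForm_apply, Finset.mul_sum,
    Function.comp_apply, Complex.ofRealCLM_apply, EuclideanSpace.coe_proj]
  refine Finset.sum_congr rfl fun k _ => ?_
  push_cast
  ring

lemma hasLineDerivAt_kernel (α : Fin n → ℝ) (x a : E n) (j : Fin n) :
    HasDerivAt (fun t : ℝ => kernel α x (a + t • EuclideanSpace.single j (1 : ℝ)))
      (Complex.I * ((a j * Real.cot (α j) - x j * (1 / Real.sin (α j)) : ℝ) : ℂ)
        * kernel α x a) 0 := by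
  have h := (hasFDerivAt_kernel α a x).hasLineDerivAt (EuclideanSpace.single j (1 : ℝ))
  rw [HasLineDerivAt] at h
  -- Symmetry of the kernel turns the derivative in the first argument into one in the second.
  simp only [← kernel_comm α x] at h
  refine h.congr_deriv ?_
  rw [sum_apply, Finset.sum_eq_single j]
  · simp
  · intro k _ hk
    simp [hk]
  · simp

lemma hasFDerivAt_translate (ψ : 𝓢(ℝ, ℂ)) (u : E n) (b : ℝ) (x : E n) :
    HasFDerivAt (fun y : E n => ψ (inner ℝ y u - b))
      (∑ j, coordForm j (u j * SchwartzMap.derivCLM ℂ ℂ ψ (inner ℝ x u - b))) x := by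
  have h1 : HasFDerivAt (fun y : E n => inner ℝ y u - b) (innerSL ℝ u) x := by
    simp_rw [real_inner_comm u]
    exact (innerSL ℝ u).hasFDerivAt.sub_const b
  have h2 := ψ.differentiableAt.hasDerivAt.hasFDerivAt.comp x h1
  refine h2.congr_fderiv ?_
  ext v
  simp [PiLp.inner_apply]
  exact Finset.sum_congr rfl fun k _ => by ring

end Kernel

/-! ### Integrability -/

section Integrability

variable {n : ℕ} [n.AtLeastTwo]

instance : IsFiniteMeasure (sphereMeasure n) := by
  refine ⟨?_⟩
  rw [sphereMeasure, Measure.smul_apply, smul_eq_mul]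
  -- `c⁻¹ * c ≤ 1` holds for every extended nonnegative `c`, so the total mass need not be computed.
  exact (ENNReal.inv_mul_le_one _).trans_lt ENNReal.one_lt_top

/-- An integrable majorant on `ℝ × ℝⁿ`. -/
def weight (c : ℝ × E n) : ℝ := (1 + c.1 ^ 2)⁻¹ * ((1 + ‖c.2‖ ^ 2) ^ n)⁻¹

/-- In `a` the weight decays like `|a|^{-2n}`, and `2n` exceeds the dimension `n`; in `b` it decays
like `b⁻²`. -/
lemma integrable_weight : Integrable (weight : ℝ × E n → ℝ) := by
  have h : Integrable fun a : E n => ((1 + ‖a‖ ^ 2) ^ n)⁻¹ := by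
    have hn : (Module.finrank ℝ (E n) : ℝ) < 2 * n := by
      rw [finrank_euclideanSpace_fin]
      have : 2 ≤ n := Nat.AtLeastTwo.prop
      have : (2 : ℝ) ≤ n := by exact_mod_cast this
      linarith
    refine (integrable_rpow_neg_one_add_norm_sq hn).congr (ae_of_all _ fun a => ?_)
    have h0 : (0 : ℝ) ≤ 1 + ‖a‖ ^ 2 := by positivity
    have h1 : -(2 * n : ℝ) / 2 = -(n : ℝ) := by ring
    simp only [h1, Real.rpow_neg h0, Real.rpow_natCast]
  exact integrable_inv_one_add_sq.mul_prod h

lemma integrable_weight_measureY : Integrable (fun p : Y n => weight p.2) (measureY n) :=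
  integrable_weight.comp_snd (sphereMeasure n)

lemma DecayBound.norm_le {L N : ℕ} {A : ℝ} {Φ : smoothFun n} (h : DecayBound L N A Φ)
    (hN : n ≤ N) (p : Y n) : ‖(Φ : Y n → ℂ) p‖ ≤ A * weight p.2 := by
  have h1 := (h.mono (Nat.zero_le L) hN le_rfl) p
  rw [weight, ← mul_inv, ← div_eq_mul_inv, le_div_iff₀ (by positivity), mul_comm]
  exact h1

lemma norm_synthIntegrand_le {L N : ℕ} {A : ℝ} {Φ : smoothFun n} (h : DecayBound L N A Φ)
    (hN : n ≤ N) (α : Fin n → ℝ) (ψ : 𝓢(ℝ, ℂ)) (x : E n) (p : Y n) :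
    ‖synthIntegrand α Φ ψ x p‖ ≤
      A * weight p.2 * SchwartzMap.seminorm ℂ 0 0 ψ * ‖kernelConst (-α)‖ := by
  rw [synthIntegrand, norm_mul, norm_mul, norm_kernel]
  have h1 := SchwartzMap.norm_le_seminorm ℂ ψ (inner ℝ x (p.1 : E n) - p.2.1)
  have h2 := h.norm_le hN p
  gcongr
  exact (norm_nonneg _).trans h2

lemma continuous_synthIntegrand (α : Fin n → ℝ) (Φ : smoothFun n) (ψ : 𝓢(ℝ, ℂ)) (x : E n) :
    Continuous (synthIntegrand α Φ ψ x) := by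
  unfold synthIntegrand
  have h1 := smoothFun_continuous Φ
  have h2 := (continuous_kernel (-α) x).comp (continuous_snd.comp (continuous_snd (X := Sph n)
    (Y := ℝ × E n)))
  have h3 : Continuous fun p : Y n => ψ (inner ℝ x (p.1 : E n) - p.2.1) :=
    ψ.continuous.comp (by fun_prop)
  exact (h1.mul h3).mul h2

lemma integrable_synthIntegrand {Φ : smoothFun n} (h : Rapid Φ) (α : Fin n → ℝ)
    (ψ : 𝓢(ℝ, ℂ)) (x : E n) : Integrable (synthIntegrand α Φ ψ x) (measureY n) := by
  obtain ⟨A, hA⟩ := h n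
  exact (((integrable_weight_measureY.const_mul A).mul_const _).mul_const _).mono'
    (continuous_synthIntegrand α Φ ψ x).aestronglyMeasurable
    (ae_of_all _ fun p => norm_synthIntegrand_le hA le_rfl α ψ x p)

lemma integrable_synthIntegrand_slice {Φ : smoothFun n} (h : Rapid Φ) (α : Fin n → ℝ)
    (ψ : 𝓢(ℝ, ℂ)) (x : E n) (u : Sph n) :
    Integrable fun c : ℝ × E n => synthIntegrand α Φ ψ x (u, c) := by
  obtain ⟨A, hA⟩ := h n
  exact (((integrable_weight.const_mul A).mul_const _).mul_const _).mono'
    ((continuous_synthIntegrand α Φ ψ x).comp (by fun_prop :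
      Continuous fun c : ℝ × E n => (u, c))).aestronglyMeasurable
    (ae_of_all _ fun c => norm_synthIntegrand_le hA le_rfl α ψ x (u, c))

/-- The synthesis operator as an integral over `𝕐^{2n}`. -/
def synth (α : Fin n → ℝ) (Φ : smoothFun n) (ψ : 𝓢(ℝ, ℂ)) (x : E n) : ℂ :=
  ∫ p, synthIntegrand α Φ ψ x p ∂(measureY n)

lemma synth_eq_integral_slice {Φ : smoothFun n} (h : Rapid Φ) (α : Fin n → ℝ)
    (ψ : 𝓢(ℝ, ℂ)) (x : E n) :
    synth α Φ ψ x = ∫ u, (∫ c : ℝ × E n, synthIntegrand α Φ ψ x (u, c)) ∂(sphereMeasure n) :=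
  integral_prod _ (integrable_synthIntegrand h α ψ x)

/-- Fubini twice; the symmetric form is needed because the inner integral of `synthesis` is over
`b`, the first coordinate. -/
lemma synth_eq_synthesis {Φ : smoothFun n} (h : Rapid Φ) (α : Fin n → ℝ)
    (ψ : 𝓢(ℝ, ℂ)) (x : E n) : synth α Φ ψ x = synthesis α Φ ψ x := by
  rw [synth_eq_integral_slice h, synthesis]
  congr 1
  funext u
  exact integral_prod_symm _ (integrable_synthIntegrand_slice h α ψ x u)

lemma synth_add {Φ Ψ : smoothFun n} (h : Rapid Φ) (h' : Rapid Ψ) (α : Fin n → ℝ)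
    (ψ : 𝓢(ℝ, ℂ)) (x : E n) : synth α (Φ + Ψ) ψ x = synth α Φ ψ x + synth α Ψ ψ x := by
  rw [synth, synth, synth, ← integral_add (integrable_synthIntegrand h α ψ x)
    (integrable_synthIntegrand h' α ψ x)]
  congr 1
  funext p
  simp only [synthIntegrand, smoothFun_add_apply]
  ring

lemma synth_smul (c : ℂ) (Φ : smoothFun n) (α : Fin n → ℝ) (ψ : 𝓢(ℝ, ℂ)) (x : E n) :
    synth α (c • Φ) ψ x = c * synth α Φ ψ x := by
  rw [synth, synth, ← integral_const_mul]
  congr 1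
  funext p
  simp only [synthIntegrand, smoothFun_smul_apply]
  ring

lemma synth_add_right {Φ : smoothFun n} (h : Rapid Φ) (α : Fin n → ℝ)
    (ψ χ : 𝓢(ℝ, ℂ)) (x : E n) : synth α Φ (ψ + χ) x = synth α Φ ψ x + synth α Φ χ x := by
  rw [synth, synth, synth, ← integral_add (integrable_synthIntegrand h α ψ x)
    (integrable_synthIntegrand h α χ x)]
  congr 1
  funext p
  simp only [synthIntegrand, add_apply]
  ring

lemma synth_smul_right (c : ℂ) (Φ : smoothFun n) (α : Fin n → ℝ) (ψ : 𝓢(ℝ, ℂ)) (x : E n) :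
    synth α Φ (c • ψ) x = c * synth α Φ ψ x := by
  rw [synth, synth, ← integral_const_mul]
  congr 1
  funext p
  simp only [synthIntegrand, smul_apply, smul_eq_mul]
  ring

/-- The only analytic estimate on the integral itself. It uses just the sup norm of `ψ` and is
uniform in `x`. -/
lemma norm_synth_le {L N : ℕ} {A : ℝ} {Φ : smoothFun n} (h : DecayBound L N A Φ)
    (hN : n ≤ N) (α : Fin n → ℝ) (ψ : 𝓢(ℝ, ℂ)) (x : E n) :
    ‖synth α Φ ψ x‖ ≤ A * ((∫ p : Y n, weight p.2 ∂(measureY n)) * ‖kernelConst (-α)‖ *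
      SchwartzMap.seminorm ℂ 0 0 ψ) := by
  refine (norm_integral_le_of_norm_le
    (((integrable_weight_measureY.const_mul A).mul_const _).mul_const _)
    (ae_of_all _ fun p => norm_synthIntegrand_le h hN α ψ x p)).trans (le_of_eq ?_)
  rw [integral_mul_const, integral_mul_const, integral_const_mul]
  ring

/-! ### Integration by parts in `a` -/

/-- The integral of `∂_{aⱼ}(Φ ψ K)` vanishes. -/
lemma synth_opA_add {Φ : smoothFun n} (h : Rapid Φ) (α : Fin n → ℝ) (ψ : 𝓢(ℝ, ℂ)) (x : E n)
    (j : Fin n) :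
    synth α (opA j Φ) ψ x + Complex.I * Real.cot ((-α) j) * synth α (mulA j Φ) ψ x =
      Complex.I * (1 / Real.sin ((-α) j) : ℝ) * x j * synth α Φ ψ x := by
  set c : ℂ := Complex.I * Real.cot ((-α) j)
  set s : ℂ := Complex.I * (1 / Real.sin ((-α) j) : ℝ) * x j
  have hA := h.apply (tame_opA j)
  have hM := h.apply (tame_mulA j)
  have hcM := hM.smul c
  have hsΦ := h.smul (-s)
  have hR := hA.add (hcM.add hsΦ)
  -- This combination is what `∂_{aⱼ}` applied to the whole integrand leaves in front of `ψ K`; its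
  -- integral over `(b, a)` vanishes for each fixed `u`.
  have key : synth α (opA j Φ + (c • mulA j Φ + (-s) • Φ)) ψ x = 0 := by
    rw [synth_eq_integral_slice hR]
    refine integral_eq_zero_of_ae (ae_of_all _ fun u => ?_)
    have hline : ∀ q : ℝ × E n, HasLineDerivAt ℝ
        (fun q : ℝ × E n => synthIntegrand α Φ ψ x (u, q))
        (synthIntegrand α (opA j Φ + (c • mulA j Φ + (-s) • Φ) : smoothFun n) ψ x
          (u, q)) q (0, EuclideanSpace.single j 1) := by
      intro q
      have h1 := ((hasDerivAt_opA j Φ (u, q)).mul_const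
        (ψ (inner ℝ x (u : E n) - q.1))).mul (hasLineDerivAt_kernel (-α) x q.2 j)
      rw [HasLineDerivAt]
      have h2 : (fun t : ℝ => synthIntegrand α Φ ψ x
          (u, q + t • ((0 : ℝ), EuclideanSpace.single j (1 : ℝ)))) =
          (fun t : ℝ => (Φ : Y n → ℂ) (u, q.1, q.2 + t • EuclideanSpace.single j (1 : ℝ)) *
            ψ (inner ℝ x (u : E n) - q.1)) *
          fun t : ℝ => kernel (-α) x (q.2 + t • EuclideanSpace.single j (1 : ℝ)) := by
        funext t
        have h3 : q + t • ((0 : ℝ), EuclideanSpace.single j (1 : ℝ)) =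
            (q.1, q.2 + t • EuclideanSpace.single j (1 : ℝ)) := by
          ext <;> simp
        simp only [synthIntegrand, h3, Pi.mul_apply]
      rw [h2]
      refine h1.congr_deriv ?_
      simp only [zero_smul, add_zero]
      have h3 : ((opA j Φ + (c • mulA j Φ + (-s) • Φ) : smoothFun n) : Y n → ℂ)
          (u, q) = (opA j Φ : Y n → ℂ) (u, q) +
            (c * (((q.2 j : ℝ) : ℂ) * (Φ : Y n → ℂ) (u, q)) + (-s) * (Φ : Y n → ℂ) (u, q)) :=
        rfl
      rw [synthIntegrand, h3]
      simp only [c, s]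
      push_cast
      ring
    have : (volume : Measure (ℝ × E n)).IsAddHaarMeasure :=
      inferInstanceAs (Measure.prod volume volume).IsAddHaarMeasure
    -- Integration by parts against the constant `1`: only the products with `1` must be integrable,
    -- not the constant itself.
    have hf := integral_bilinear_hasLineDerivAt_right_eq_neg_left_of_integrable
      (μ := (volume : Measure (ℝ × E n))) (f := fun _ => (1 : ℂ)) (f' := fun _ => 0)
      (g := fun q : ℝ × E n => synthIntegrand α Φ ψ x (u, q))
      (g' := fun q : ℝ × E n => synthIntegrand α
        (opA j Φ + (c • mulA j Φ + (-s) • Φ) : smoothFun n) ψ x (u, q))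
      (B := ContinuousLinearMap.mul ℝ ℂ) (v := (0, EuclideanSpace.single j 1))
      (by simp) (by simpa using integrable_synthIntegrand_slice hR α ψ x u)
      (by simpa using integrable_synthIntegrand_slice h α ψ x u)
      (fun q _ => by simpa [HasLineDerivAt] using hasDerivAt_const (0 : ℝ) (1 : ℂ))
      (fun q _ => hline q)
    simpa using hf
  rw [synth_add hA (hcM.add hsΦ), synth_add hcM hsΦ, synth_smul, synth_smul] at key
  linear_combination key

/-- The operator on `Φ` which corresponds to multiplication of `(DS_ψ^α)^* Φ` by `xⱼ`. -/
def mulX (α : Fin n → ℝ) (j : Fin n) : Module.End ℂ (smoothFun n) :=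
  (Real.cos ((-α) j) : ℂ) • mulA j + (-Complex.I * Real.sin ((-α) j)) • opA j

lemma tame_mulX (α : Fin n → ℝ) (j : Fin n) : Tame (mulX α j) :=
  ((tame_mulA j).smul _).add ((tame_opA j).smul _)

lemma synth_mulX {Φ : smoothFun n} (h : Rapid Φ) {α : Fin n → ℝ} {j : Fin n}
    (hα : Real.sin (α j) ≠ 0) (ψ : 𝓢(ℝ, ℂ)) (x : E n) :
    synth α (mulX α j Φ) ψ x = x j * synth α Φ ψ x := by
  have h1 : synth α (mulX α j Φ) ψ x = Real.cos ((-α) j) * synth α (mulA j Φ) ψ x +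
      (-Complex.I * Real.sin ((-α) j)) * synth α (opA j Φ) ψ x := by
    rw [← synth_smul, ← synth_smul, ← synth_add ((h.apply (tame_mulA j)).smul _)
      ((h.apply (tame_opA j)).smul _)]
    rfl
  have hs : (Real.sin ((-α) j) : ℂ) ≠ 0 := by
    rw [Pi.neg_apply, Real.sin_neg]
    exact_mod_cast neg_ne_zero.2 hα
  have h2 := synth_opA_add h α ψ x j
  rw [Real.cot_eq_cos_div_sin] at h2
  push_cast at h1 h2 hs ⊢
  field_simp at h2
  rw [h1]
  -- The integration-by-parts identity multiplied by `-i sin βⱼ`, where `β = -α`; the sine was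
  -- cleared by `field_simp`, and `i² = -1` does the rest.
  linear_combination (-Complex.I) * h2 + (Complex.cos (((-α) j : ℝ) : ℂ) *
    synth α (mulA j Φ) ψ x - x j * synth α Φ ψ x) * Complex.I_sq

/-! ### Differentiation under the integral sign -/

/-- The `j`-th partial derivative of the integrand. -/
def gradIntegrand (α : Fin n → ℝ) (Φ : smoothFun n) (ψ : 𝓢(ℝ, ℂ)) (j : Fin n) (x : E n)
    (p : Y n) : ℂ :=
  synthIntegrand α (mulU j Φ) (SchwartzMap.derivCLM ℂ ℂ ψ) x p +
    (Complex.I * Real.cot ((-α) j) * x j * synthIntegrand α Φ ψ x p -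
      Complex.I * (1 / Real.sin ((-α) j) : ℝ) * synthIntegrand α (mulA j Φ) ψ x p)

lemma hasFDerivAt_synthIntegrand (α : Fin n → ℝ) (Φ : smoothFun n) (ψ : 𝓢(ℝ, ℂ)) (x : E n)
    (p : Y n) : HasFDerivAt (fun y => synthIntegrand α Φ ψ y p)
      (∑ j, coordForm j (gradIntegrand α Φ ψ j x p)) x := by
  have h := ((hasFDerivAt_translate ψ (p.1 : E n) p.2.1 x).const_mul ((Φ : Y n → ℂ) p)).mul
    (hasFDerivAt_kernel (-α) x p.2.2)
  refine h.congr_fderiv ?_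
  ext v
  simp only [add_apply, smul_apply, sum_apply, smul_eq_mul,
    coordForm_apply, Finset.mul_sum, gradIntegrand, synthIntegrand, mulU_apply, mulA_apply]
  rw [← Finset.sum_add_distrib]
  refine Finset.sum_congr rfl fun k _ => ?_
  push_cast
  ring

lemma integrable_gradIntegrand {Φ : smoothFun n} (h : Rapid Φ) (α : Fin n → ℝ)
    (ψ : 𝓢(ℝ, ℂ)) (j : Fin n) (x : E n) :
    Integrable (gradIntegrand α Φ ψ j x) (measureY n) :=
  (integrable_synthIntegrand (h.apply (tame_mulU j)) α _ x).add
    (((integrable_synthIntegrand h α ψ x).const_mul _).sub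
      ((integrable_synthIntegrand (h.apply (tame_mulA j)) α ψ x).const_mul _))

/-- The explicit factor `xⱼ` makes the bound only locally uniform in `x`, which is enough for
dominated differentiation. -/
lemma exists_gradIntegrand_bound {Φ : smoothFun n} (h : Rapid Φ) (α : Fin n → ℝ)
    (ψ : 𝓢(ℝ, ℂ)) (j : Fin n) (R : ℝ) :
    ∃ C : ℝ, ∀ x : E n, ‖x‖ ≤ R → ∀ p, ‖gradIntegrand α Φ ψ j x p‖ ≤ C * weight p.2 := by
  obtain ⟨A₁, h₁⟩ := h.apply (tame_mulU j) n
  obtain ⟨A₂, h₂⟩ := h n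
  obtain ⟨A₃, h₃⟩ := h.apply (tame_mulA j) n
  set κ := ‖kernelConst (-α)‖
  refine ⟨A₁ * SchwartzMap.seminorm ℂ 0 0 (SchwartzMap.derivCLM ℂ ℂ ψ) * κ +
    (|Real.cot ((-α) j)| * R * (A₂ * SchwartzMap.seminorm ℂ 0 0 ψ * κ) +
      |1 / Real.sin ((-α) j)| * (A₃ * SchwartzMap.seminorm ℂ 0 0 ψ * κ)), fun x hx p => ?_⟩
  have e₁ := norm_synthIntegrand_le h₁ le_rfl α (SchwartzMap.derivCLM ℂ ℂ ψ) x p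
  have e₂ := norm_synthIntegrand_le h₂ le_rfl α ψ x p
  have e₃ := norm_synthIntegrand_le h₃ le_rfl α ψ x p
  have hR : |x j| ≤ R := (abs_apply_le_norm x j).trans hx
  have hR0 : 0 ≤ R := (abs_nonneg _).trans hR
  have f₂ : ‖Complex.I * Real.cot ((-α) j) * x j * synthIntegrand α Φ ψ x p‖ ≤
      |Real.cot ((-α) j)| * R * (A₂ * weight p.2 * SchwartzMap.seminorm ℂ 0 0 ψ * κ) := by
    rw [norm_mul, norm_mul, norm_mul, Complex.norm_I, one_mul, Complex.norm_real,
      Complex.norm_real, norm_eq_abs, norm_eq_abs]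
    gcongr
  have f₃ : ‖Complex.I * (1 / Real.sin ((-α) j) : ℝ) * synthIntegrand α (mulA j Φ) ψ x p‖ ≤
      |1 / Real.sin ((-α) j)| * (A₃ * weight p.2 * SchwartzMap.seminorm ℂ 0 0 ψ * κ) := by
    rw [norm_mul, norm_mul, Complex.norm_I, one_mul, Complex.norm_real, norm_eq_abs]
    gcongr
  refine (norm_add_le _ _).trans ((add_le_add e₁ ((norm_sub_le _ _).trans
    (add_le_add f₂ f₃))).trans (le_of_eq ?_))
  ring

/-- The operator on `Φ` which, together with `mulU j` and differentiation of `ψ`, corresponds to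
the `j`-th partial derivative of `(DS_ψ^α)^* Φ`. -/
def derivX (α : Fin n → ℝ) (j : Fin n) : Module.End ℂ (smoothFun n) :=
  (Complex.I * Real.cot ((-α) j)) • mulX α j +
    (-(Complex.I * (1 / Real.sin ((-α) j) : ℝ))) • mulA j

lemma tame_derivX (α : Fin n → ℝ) (j : Fin n) : Tame (derivX α j) :=
  ((tame_mulX α j).smul _).add ((tame_mulA j).smul _)

/-- The factor `xⱼ` is absorbed into `Φ` by `synth_mulX`. What remains are again synthesis integrals
with no explicit `x`, so differentiation can be iterated. -/
lemma integral_gradIntegrand {Φ : smoothFun n} (h : Rapid Φ) {α : Fin n → ℝ} {j : Fin n}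
    (hα : Real.sin (α j) ≠ 0) (ψ : 𝓢(ℝ, ℂ)) (x : E n) :
    ∫ p, gradIntegrand α Φ ψ j x p ∂(measureY n) =
      synth α (mulU j Φ) (SchwartzMap.derivCLM ℂ ℂ ψ) x + synth α (derivX α j Φ) ψ x := by
  have h1 : synth α (derivX α j Φ) ψ x =
      Complex.I * Real.cot ((-α) j) * synth α (mulX α j Φ) ψ x +
      (-(Complex.I * (1 / Real.sin ((-α) j) : ℝ))) * synth α (mulA j Φ) ψ x := by
    rw [← synth_smul, ← synth_smul, ← synth_add ((h.apply (tame_mulX α j)).smul _)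
      ((h.apply (tame_mulA j)).smul _)]
    rfl
  have i₁ := integrable_synthIntegrand (h.apply (tame_mulU j)) α (SchwartzMap.derivCLM ℂ ℂ ψ) x
  have i₂ := (integrable_synthIntegrand h α ψ x).const_mul
    (Complex.I * Real.cot ((-α) j) * x j)
  have i₃ := (integrable_synthIntegrand (h.apply (tame_mulA j)) α ψ x).const_mul
    (Complex.I * (1 / Real.sin ((-α) j) : ℝ))
  rw [h1, synth_mulX h hα]
  refine (integral_add i₁ (i₂.sub i₃)).trans ?_
  rw [integral_sub' i₂ i₃, integral_const_mul, integral_const_mul]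
  simp only [synth]
  ring

end Integrability

/-- A form of `integrable_finsetSum` with fast unification in spaces of continuous linear maps. -/
lemma integrable_sum {X F ι : Type*} [Fintype ι] [MeasurableSpace X] [NormedAddCommGroup F]
    {μ : Measure X} {f : ι → X → F} (h : ∀ j, Integrable (f j) μ) :
    Integrable (fun p => ∑ j, f j p) μ :=
  integrable_finsetSum Finset.univ fun j _ => h j

lemma integral_sum {X F ι : Type*} [Fintype ι] [MeasurableSpace X] [NormedAddCommGroup F]
    [NormedSpace ℝ F] {μ : Measure X} {f : ι → X → F} (h : ∀ j, Integrable (f j) μ) :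
    ∫ p, ∑ j, f j p ∂μ = ∑ j, ∫ p, f j p ∂μ :=
  integral_finsetSum Finset.univ fun j _ => h j

lemma norm_iteratedFDeriv_sum_le {V F ι : Type*} [Fintype ι] [NormedAddCommGroup V]
    [NormedSpace ℝ V] [NormedAddCommGroup F] [NormedSpace ℝ F] {m : ℕ} {f : ι → V → F}
    (hf : ∀ j, ContDiff ℝ m (f j)) (x : V) :
    ‖iteratedFDeriv ℝ m (fun x => ∑ j, f j x) x‖ ≤ ∑ j, ‖iteratedFDeriv ℝ m (f j) x‖ := by
  rw [iteratedFDeriv_sum fun j _ => hf j, Finset.sum_apply]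
  exact norm_sum_le _ _

/-! ### Smoothness of the synthesized function -/

variable {n : ℕ} [n.AtLeastTwo]

lemma hasFDerivAt_synth {Φ : smoothFun n} (h : Rapid Φ) {α : Fin n → ℝ}
    (hα : ∀ j, Real.sin (α j) ≠ 0) (ψ : 𝓢(ℝ, ℂ)) (x : E n) :
    HasFDerivAt (synth α Φ ψ) (∑ j, coordForm j
      (synth α (mulU j Φ) (SchwartzMap.derivCLM ℂ ℂ ψ) x + synth α (derivX α j Φ) ψ x)) x := by
  -- The unit ball around `x` lies in the ball of radius `‖x‖ + 1` around the origin.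
  choose C hC using fun j => exists_gradIntegrand_bound h α ψ j (‖x‖ + 1)
  have hint : ∀ j, Integrable (fun p => coordForm j (gradIntegrand α Φ ψ j x p)) (measureY n) :=
    fun j => (coordForm j).integrable_comp (integrable_gradIntegrand h α ψ j x)
  have hint' : Integrable (fun p => ∑ j, coordForm j (gradIntegrand α Φ ψ j x p))
      (measureY n) := integrable_sum hint
  have hbound : Integrable (fun p : Y n => ∑ j,
      ‖(coordForm j : ℂ →L[ℝ] E n →L[ℝ] ℂ)‖ * (C j * weight p.2)) (measureY n) :=
    integrable_sum fun j => (integrable_weight_measureY.const_mul _).const_mul _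
  have hle : ∀ p : Y n, ∀ y ∈ Metric.ball x 1,
      ‖∑ j, coordForm j (gradIntegrand α Φ ψ j y p)‖ ≤
        ∑ j, ‖(coordForm j : ℂ →L[ℝ] E n →L[ℝ] ℂ)‖ * (C j * weight p.2) := by
    intro p y hy
    refine (norm_sum_le _ _).trans (Finset.sum_le_sum fun j _ => ?_)
    refine ((coordForm j).le_opNorm _).trans
      (mul_le_mul_of_nonneg_left (hC j y ?_ p) (norm_nonneg _))
    rw [mem_ball_iff_norm] at hy
    have := norm_add_le (y - x) x
    rw [sub_add_cancel] at this
    linarith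
  have key := hasFDerivAt_integral_of_dominated_of_fderiv_le (𝕜 := ℝ) (μ := measureY n)
    (F := fun y p => synthIntegrand α Φ ψ y p)
    (F' := fun y p => ∑ j, coordForm j (gradIntegrand α Φ ψ j y p))
    (Metric.ball_mem_nhds x one_pos)
    (Filter.Eventually.of_forall fun y =>
      (continuous_synthIntegrand α Φ ψ y).aestronglyMeasurable)
    (integrable_synthIntegrand h α ψ x) hint'.aestronglyMeasurable
    (ae_of_all _ hle) hbound
    (ae_of_all _ fun p y _ => hasFDerivAt_synthIntegrand α Φ ψ y p)
  refine key.congr_fderiv ?_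
  rw [integral_sum hint]
  refine Finset.sum_congr rfl fun j _ => ?_
  rw [(coordForm j).integral_comp_comm (integrable_gradIntegrand h α ψ j x),
    integral_gradIntegrand h (hα j)]

lemma contDiff_synth {α : Fin n → ℝ} (hα : ∀ j, Real.sin (α j) ≠ 0) (m : ℕ) {Φ : smoothFun n}
    (h : Rapid Φ) (ψ : 𝓢(ℝ, ℂ)) : ContDiff ℝ m (synth α Φ ψ) := by
  -- The derivative involves new pairs, `(uⱼ Φ, ψ')` and `(Dⱼ Φ, ψ)`, so both arguments must vary.
  induction m generalizing Φ ψ with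
  | zero =>
    have hd : Differentiable ℝ (synth α Φ ψ) := fun x =>
      (hasFDerivAt_synth h hα ψ x).differentiableAt
    exact contDiff_zero.2 hd.continuous
  | succ m ih =>
    push_cast
    exact contDiff_succ_iff_hasFDerivAt.2 ⟨_, ContDiff.sum fun j _ =>
      (coordForm j).contDiff.comp ((ih (h.apply (tame_mulU j)) _).add
        (ih (h.apply (tame_derivX α j)) ψ)), hasFDerivAt_synth h hα ψ⟩

/-! ### Seminorm estimates -/

/-- Bounds by the product of a decay constant of `Φ` and a continuous seminorm of `ψ`. -/
def Controlled (T : smoothFun n → 𝓢(ℝ, ℂ) → E n → ℝ) : Prop :=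
  ∃ N : ℕ, ∃ q : Seminorm ℂ 𝓢(ℝ, ℂ), Continuous q ∧
    ∀ Φ A, Rapid Φ → DecayBound N N A Φ → ∀ ψ x, T Φ ψ x ≤ A * q ψ

lemma Controlled.mono {T T' : smoothFun n → 𝓢(ℝ, ℂ) → E n → ℝ} (h : Controlled T)
    (hT : ∀ Φ, Rapid Φ → ∀ ψ x, T' Φ ψ x ≤ T Φ ψ x) : Controlled T' := by
  obtain ⟨N, q, hq, h⟩ := h
  exact ⟨N, q, hq, fun Φ A hΦ hA ψ x => (hT Φ hΦ ψ x).trans (h Φ A hΦ hA ψ x)⟩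

lemma Controlled.add {T T' : smoothFun n → 𝓢(ℝ, ℂ) → E n → ℝ} (h : Controlled T)
    (h' : Controlled T') : Controlled fun Φ ψ x => T Φ ψ x + T' Φ ψ x := by
  obtain ⟨N, q, hq, h⟩ := h
  obtain ⟨N', q', hq', h'⟩ := h'
  refine ⟨max N N', q + q', hq.add hq', fun Φ A hΦ hA ψ x => ?_⟩
  rw [add_apply, mul_add]
  exact add_le_add (h Φ A hΦ (hA.mono (le_max_left _ _) (le_max_left _ _) le_rfl) ψ x)
    (h' Φ A hΦ (hA.mono (le_max_right _ _) (le_max_right _ _) le_rfl) ψ x)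

lemma Controlled.sum {ι : Type*} (s : Finset ι) {T : ι → smoothFun n → 𝓢(ℝ, ℂ) → E n → ℝ}
    (h : ∀ j, Controlled (T j)) : Controlled fun Φ ψ x => ∑ j ∈ s, T j Φ ψ x := by
  classical
  induction s using Finset.induction_on with
  | empty => exact ⟨0, 0, continuous_const, fun Φ A _ _ ψ x => by simp⟩
  | insert j s hj ih =>
    simp only [Finset.sum_insert hj]
    exact (h j).add ih

lemma continuous_nnreal_smul {F : Type*} [AddCommGroup F] [Module ℂ F] [TopologicalSpace F]
    {q : Seminorm ℂ F} (hq : Continuous q) (c : NNReal) : Continuous (c • q) :=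
  hq.const_smul c

lemma Controlled.const_mul {T : smoothFun n → 𝓢(ℝ, ℂ) → E n → ℝ} (h : Controlled T)
    (c : NNReal) : Controlled fun Φ ψ x => c * T Φ ψ x := by
  obtain ⟨N, q, hq, h⟩ := h
  refine ⟨N, c • q, continuous_nnreal_smul hq c, fun Φ A hΦ hA ψ x => ?_⟩
  rw [smul_apply, NNReal.smul_def, smul_eq_mul, mul_left_comm]
  exact mul_le_mul_of_nonneg_left (h Φ A hΦ hA ψ x) c.2

lemma Controlled.comp {T : smoothFun n → 𝓢(ℝ, ℂ) → E n → ℝ} (h : Controlled T)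
    {X : Module.End ℂ (smoothFun n)} (hX : Tame X) :
    Controlled fun Φ ψ x => T (X Φ) ψ x := by
  obtain ⟨N, q, hq, h⟩ := h
  obtain ⟨N', C, hC⟩ := hX N
  -- `Tame` does not make `C` nonnegative, and a seminorm can only be scaled by a nonnegative
  -- number.
  refine ⟨N', ‖C‖₊ • q, continuous_nnreal_smul hq _, fun Φ A hΦ hA ψ x => ?_⟩
  refine (h _ _ (hΦ.apply hX) (hC Φ A hA) ψ x).trans ?_
  rw [smul_apply, NNReal.smul_def, smul_eq_mul, coe_nnnorm, ← mul_assoc, mul_comm C A]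
  exact mul_le_mul_of_nonneg_right (mul_le_mul_of_nonneg_left (le_abs_self C) hA.nonneg)
    (apply_nonneg q ψ)

lemma Controlled.comp_deriv {T : smoothFun n → 𝓢(ℝ, ℂ) → E n → ℝ} (h : Controlled T) :
    Controlled fun Φ ψ x => T Φ (SchwartzMap.derivCLM ℂ ℂ ψ) x := by
  obtain ⟨N, q, hq, h⟩ := h
  exact ⟨N, q.comp (SchwartzMap.derivCLM ℂ ℂ).toLinearMap,
    hq.comp (SchwartzMap.derivCLM ℂ ℂ).continuous, fun Φ A hΦ hA ψ x => h Φ A hΦ hA _ x⟩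

lemma continuous_seminorm_zero :
    Continuous (SchwartzMap.seminorm ℂ 0 0 : Seminorm ℂ 𝓢(ℝ, ℂ)) :=
  (schwartz_withSeminorms ℂ ℝ ℂ).continuous_seminorm (0, 0)

/-- Each power of `‖x‖` is bounded by `∑ |xⱼ|`, and each `xⱼ` passes into `Φ` as the tame operator
`mulX α j`; the case `k = 0` is the sup bound. -/
lemma controlled_pow_mul_norm {α : Fin n → ℝ} (hα : ∀ j, Real.sin (α j) ≠ 0) (k : ℕ) :
    Controlled fun Φ ψ x => ‖x‖ ^ k * ‖synth (n := n) α Φ ψ x‖ := by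
  induction k with
  | zero =>
    set c : NNReal := ⟨(∫ p : Y n, weight p.2 ∂(measureY n)) * ‖kernelConst (-α)‖,
      mul_nonneg (integral_nonneg fun p => by simp only [weight, Pi.zero_apply]; positivity)
        (norm_nonneg _)⟩
    refine ⟨n, c • SchwartzMap.seminorm ℂ 0 0,
      continuous_nnreal_smul continuous_seminorm_zero c, fun Φ A _ hA ψ x => ?_⟩
    simp only [pow_zero, one_mul]
    rw [smul_apply, NNReal.smul_def, smul_eq_mul]
    exact norm_synth_le hA le_rfl α ψ x
  | succ k ih =>
    refine (Controlled.sum Finset.univ fun j => ih.comp (tame_mulX α j)).mono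
      fun Φ hΦ ψ x => ?_
    have h1 : ∀ j, ‖x‖ ^ k * ‖synth α (mulX α j Φ) ψ x‖ =
        |x j| * (‖x‖ ^ k * ‖synth α Φ ψ x‖) := by
      intro j
      rw [synth_mulX hΦ (hα j), norm_mul, Complex.norm_real, norm_eq_abs, mul_left_comm]
    simp only [h1]
    rw [← Finset.sum_mul, pow_succ', mul_assoc]
    exact mul_le_mul_of_nonneg_right (norm_le_sum_abs x) (by positivity)

/-- Induction on the order: one derivative is replaced by the formula of `hasFDerivAt_synth`, whose
terms are controlled because `mulU j` and `derivX α j` are tame and `ψ ↦ ψ'` is continuous. -/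
lemma controlled_pow_mul_norm_iteratedFDeriv {α : Fin n → ℝ} (hα : ∀ j, Real.sin (α j) ≠ 0)
    (k m : ℕ) :
    Controlled fun Φ ψ x => ‖x‖ ^ k * ‖iteratedFDeriv ℝ m (synth (n := n) α Φ ψ) x‖ := by
  induction m with
  | zero =>
    simp only [norm_iteratedFDeriv_zero]
    exact controlled_pow_mul_norm hα k
  | succ m ih =>
    refine (Controlled.sum Finset.univ fun j => ((ih.comp_deriv.comp (tame_mulU j)).add
      (ih.comp (tame_derivX α j))).const_mul
        ‖(coordForm j : ℂ →L[ℝ] E n →L[ℝ] ℂ)‖₊).mono fun Φ hΦ ψ x => ?_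
    have hU := fun j => contDiff_synth hα m (hΦ.apply (tame_mulU j))
      (SchwartzMap.derivCLM ℂ ℂ ψ)
    have hD := fun j => contDiff_synth hα m (hΦ.apply (tame_derivX α j)) ψ
    have hf : fderiv ℝ (synth α Φ ψ) = fun x => ∑ j, (coordForm j ∘
        (synth α (mulU j Φ) (SchwartzMap.derivCLM ℂ ℂ ψ) + synth α (derivX α j Φ) ψ)) x :=
      funext fun x => (hasFDerivAt_synth hΦ hα ψ x).fderiv
    have hc := fun j => (coordForm j : ℂ →L[ℝ] E n →L[ℝ] ℂ).contDiff.comp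
      (ContDiff.add (f := synth α (mulU j Φ) (SchwartzMap.derivCLM ℂ ℂ ψ)) (hU j) (hD j))
    rw [← norm_iteratedFDeriv_fderiv, hf]
    refine (mul_le_mul_of_nonneg_left (norm_iteratedFDeriv_sum_le hc x) (by positivity)).trans ?_
    rw [Finset.mul_sum]
    refine Finset.sum_le_sum fun j _ => ?_
    have h1 : _ ≤ ‖(coordForm j : ℂ →L[ℝ] E n →L[ℝ] ℂ)‖ * ‖iteratedFDeriv ℝ m
        (synth α (mulU j Φ) (SchwartzMap.derivCLM ℂ ℂ ψ) + synth α (derivX α j Φ) ψ) x‖ :=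
      (coordForm j).norm_iteratedFDeriv_comp_left (x := x)
      ((hU j).add (hD j)).contDiffAt le_rfl
    rw [iteratedFDeriv_add (hU j) (hD j)] at h1
    refine (mul_le_mul_of_nonneg_left (h1.trans (mul_le_mul_of_nonneg_left (norm_add_le _ _)
      (ContinuousLinearMap.opNorm_nonneg _))) (by positivity)).trans (le_of_eq ?_)
    rw [coe_nnnorm]
    ring

/-! ### The synthesis operator on Schwartz functions -/

/-- `(DS_ψ^α)^* Φ` as a Schwartz function. -/
def synthSchwartz {α : Fin n → ℝ} (hα : ∀ j, Real.sin (α j) ≠ 0) (Φ : SchwartzY n)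
    (ψ : 𝓢(ℝ, ℂ)) : 𝓢(E n, ℂ) where
  toFun := synth α Φ.toSmooth ψ
  smooth' := contDiff_infty.2 fun m => contDiff_synth hα m (rapid_toSmooth Φ) ψ
  decay' k m := by
    obtain ⟨N, q, _, h⟩ := controlled_pow_mul_norm_iteratedFDeriv hα k m
    obtain ⟨A, hA⟩ := rapid_toSmooth Φ N
    exact ⟨A * q ψ, h _ A (rapid_toSmooth Φ) hA ψ⟩

/-- `(Φ, ψ) ↦ (DS_ψ^α)^* Φ` as a bilinear map. -/
def synthBilin {α : Fin n → ℝ} (hα : ∀ j, Real.sin (α j) ≠ 0) :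
    SchwartzY n →ₗ[ℂ] 𝓢(ℝ, ℂ) →ₗ[ℂ] 𝓢(E n, ℂ) :=
  LinearMap.mk₂ ℂ (synthSchwartz hα)
    (fun Φ Ψ ψ => SchwartzMap.ext fun x =>
      synth_add (rapid_toSmooth Φ) (rapid_toSmooth Ψ) α ψ x)
    (fun c Φ ψ => SchwartzMap.ext fun x => synth_smul c Φ.toSmooth α ψ x)
    (fun Φ ψ χ => SchwartzMap.ext fun x => synth_add_right (rapid_toSmooth Φ) α ψ χ x)
    (fun c Φ ψ => SchwartzMap.ext fun x => synth_smul_right c Φ.toSmooth α ψ x)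

/-- The decay constant of `Φ` is taken to be `q Φ`, which turns the control into a product bound. -/
lemma exists_seminorm_synthBilin_le {α : Fin n → ℝ} (hα : ∀ j, Real.sin (α j) ≠ 0) (k m : ℕ) :
    ∃ (q : Seminorm ℂ (SchwartzY n)) (r : Seminorm ℂ 𝓢(ℝ, ℂ)), Continuous q ∧ Continuous r ∧
      ∀ Φ ψ, SchwartzMap.seminorm ℂ k m (synthBilin hα Φ ψ) ≤ q Φ * r ψ := by
  obtain ⟨N, r, hr, h⟩ := controlled_pow_mul_norm_iteratedFDeriv hα k m
  obtain ⟨q, hq, hb⟩ := exists_decayBound_toSmooth (n := n) N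
  exact ⟨q, r, hq, hr, fun Φ ψ => SchwartzMap.seminorm_le_bound ℂ k m _
    (mul_nonneg (apply_nonneg q Φ) (apply_nonneg r ψ))
    (h _ _ (rapid_toSmooth Φ) (hb Φ) ψ)⟩

/-- A bilinear map is jointly continuous if each seminorm of its values is bounded by a product of
continuous seminorms. -/
lemma continuous_bilin_of_seminorm_le {V W Z ι : Type*} [AddCommGroup V] [Module ℂ V]
    [TopologicalSpace V] [IsTopologicalAddGroup V] [AddCommGroup W] [Module ℂ W]
    [TopologicalSpace W] [IsTopologicalAddGroup W] [AddCommGroup Z] [Module ℂ Z]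
    [TopologicalSpace Z] {p : SeminormFamily ℂ Z ι} (hp : WithSeminorms p)
    (T : V →ₗ[ℂ] W →ₗ[ℂ] Z)
    (hT : ∀ i, ∃ (q : Seminorm ℂ V) (r : Seminorm ℂ W), Continuous q ∧ Continuous r ∧
      ∀ v w, p i (T v w) ≤ q v * r w) :
    Continuous fun P : V × W => T P.1 P.2 := by
  rw [continuous_iff_continuousAt]
  rintro ⟨v₀, w₀⟩
  refine (hp.tendsto_nhds _ _).2 fun i ε hε => ?_
  obtain ⟨q, r, hq, hr, h⟩ := hT i
  have hlim : Filter.Tendsto (fun P : V × W => q (P.1 - v₀) * r (P.2 - w₀) +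
      (q (P.1 - v₀) * r w₀ + q v₀ * r (P.2 - w₀))) (nhds (v₀, w₀)) (nhds 0) := by
    have hc : Continuous (fun P : V × W => q (P.1 - v₀) * r (P.2 - w₀) +
        (q (P.1 - v₀) * r w₀ + q v₀ * r (P.2 - w₀))) := by fun_prop
    simpa using hc.tendsto (v₀, w₀)
  filter_upwards [hlim.eventually_lt_const hε] with P hP
  -- Expansion around `(v₀, w₀)`: one term small in both arguments and two small in one.
  have hsplit : T P.1 P.2 - T v₀ w₀ =
      T (P.1 - v₀) (P.2 - w₀) + (T (P.1 - v₀) w₀ + T v₀ (P.2 - w₀)) := by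
    simp only [map_sub, LinearMap.sub_apply]
    abel
  rw [hsplit]
  exact ((map_add_le_add _ _ _).trans (add_le_add (h _ _) ((map_add_le_add _ _ _).trans
    (add_le_add (h _ _) (h _ _))))).trans_lt hP

end DSTFRFT

end

/-- The integral defining `(DS_ψ^α)^* Φ(x)` converges absolutely, and
`(Φ, ψ) ↦ (DS_ψ^α)^* Φ` is a continuous bilinear map `𝒮(𝕐^{2n}) × 𝒮(ℝ) → 𝒮(ℝⁿ)`. -/
theorem theorem4p2 (n : ℕ) [n.AtLeastTwo] (α : Fin n → ℝ)
    (hα : ∀ k, α k ∈ Set.Ioo (-π) π ∧ α k ≠ 0) :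
    (∀ (Φ : DSTFRFT.SchwartzY n) (ψ : 𝓢(ℝ, ℂ)) (x : EuclideanSpace ℝ (Fin n)),
      Integrable (DSTFRFT.synthIntegrand α Φ ψ x) (DSTFRFT.measureY n)) ∧
    ∃ T : DSTFRFT.SchwartzY n →ₗ[ℂ] 𝓢(ℝ, ℂ) →ₗ[ℂ] 𝓢(EuclideanSpace ℝ (Fin n), ℂ),
      (∀ (Φ : DSTFRFT.SchwartzY n) (ψ : 𝓢(ℝ, ℂ)) (x : EuclideanSpace ℝ (Fin n)),
        T Φ ψ x = DSTFRFT.synthesis α Φ ψ x) ∧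
      Continuous (fun P : DSTFRFT.SchwartzY n × 𝓢(ℝ, ℂ) => T P.1 P.2) := by
  -- The range of `α` enters only here; a nonzero sine is what allows solving the
  -- integration-by-parts identity for `xⱼ`.
  have hsin : ∀ k, Real.sin (α k) ≠ 0 := by
    intro k h
    exact (hα k).2 ((Real.sin_eq_zero_iff_of_lt_of_lt (hα k).1.1 (hα k).1.2).1 h)
  have : IsTopologicalAddGroup (DSTFRFT.SchwartzY n) :=
    DSTFRFT.SchwartzY.withSeminorms.topologicalAddGroup
  exact ⟨fun Φ ψ x => DSTFRFT.integrable_synthIntegrand (DSTFRFT.rapid_toSmooth Φ) α ψ x,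
    DSTFRFT.synthBilin hsin,
    fun Φ ψ x => DSTFRFT.synth_eq_synthesis (DSTFRFT.rapid_toSmooth Φ) α ψ x,
    DSTFRFT.continuous_bilin_of_seminorm_le (schwartz_withSeminorms ℂ _ ℂ) _
      fun i => DSTFRFT.exists_seminorm_synthBilin_le hsin i.1 i.2⟩
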